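/- Let $n,M\ge 1$, let $H_{\rm i},H_{\rm f}$ be self-adjoint operators on $(\mathbb C^2)^{\otimes n}$, and let $H(\lambda)=(1-\lambda)H_{\rm i}+\lambda H_{\rm f}$ for $\lambda\in[0,1]$. Let $P_0,\dots,P_{M-1}\in\{I,X,Y,Z\}^{\otimes n}$ be Pauli strings, and for $\theta\in\mathbb R^M$ put $|\psi(\theta)\rangle=e^{-i\theta_{M-1}P_{M-1}}\cdots e^{-i\theta_0P_0}|0\rangle$, $E_\lambda(\theta)=\langle\psi(\theta)|H(\lambda)|\psi(\theta)\rangle$ and $g_{\mu\nu}(\theta)=\mathrm{Re}\big(\langle\partial_\mu\psi|\partial_\nu\psi\rangle-\langle\partial_\mu\psi|\psi\rangle\langle\psi|\partial_\nu\psi\rangle\big)$. Let $E_0(\lambda)<E_1(\lambda)$ be the two lowest energy levels of $H(\lambda)$, $\Delta_{\min}=\min_{\lambda\in[0,1]}(E_1(\lambda)-E_0(\lambda))$ and $\|H\|=\max_{\lambda\in[0,1]}\|H(\lambda)\|_{\rm op}$; all operator norms are the usual ones, and $\|\cdot\|_2$ is the Euclidean norm on $\mathbb R^M$. Assume: (1)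 for every $\lambda\in[0,1]$ the ground level of $H(\lambda)$ is nondegenerate, and $\Delta_{\min}>0$; (2) there is a map $\theta^\star:[0,1]\to\mathbb R^M$, continuous in $\lambda$, such that $|\psi(\theta^\star(\lambda))\rangle$ is a ground state of $H(\lambda)$ (up to a phase) for every $\lambda$; (3) there is $\gamma>0$ with $g(\theta^\star(\lambda))\succeq\gamma I$ for every $\lambda$. For integers $T\ge1$, $K\ge0$ and a learning rate $\eta$, warm-started gradient descent starts at $\theta_0=\theta^\star(0)$ and, for $t=1,\dots,T$, obtains $\theta_t=\theta_t^{(K)}$ from $\theta_t^{(0)}=\theta_{t-1}$ by the $K$ steps $\theta_t^{(k+1)}=\theta_t^{(k)}-\eta\nabla E_{\lambda_t}(\theta_t^{(k)})$, where $\lambda_t=t\,\delta\lambda$ and $\delta\lambda=1/T$; it uses $N_{\rm updates}=TK$ updates. Put $L_H=24\|H\|M^{3/2}$ and $r=\gamma\Delta_{\min}/L_H$. Then every $E_\lambda$, $\lambda\in[0,1]$, is $4M\|H\|$-smooth (its gradient is $4M\|H\|$-Lipschitz). Let $L\le 4M\|H\|$ be any number such that every $E_\lambda$ is $L$-smooth,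 and let $\eta=1/L$. We say that the run with parameters $(T,K)$ tracks the ground state if (i) $\|\theta_t-\theta^\star(\lambda_t)\|_2\le r/2$ for $t=0,\dots,T$; (ii) $\|\theta_t^{(k)}-\theta^\star(\lambda_t)\|_2\le(1-\gamma\Delta_{\min}/L)^{k/2}\,r$ for $t=1,\dots,T$ and $k=0,\dots,K$; (iii) the final ground state is reached: if $\theta_T$ is followed by $k\ge0$ more steps of gradient descent on $E_1$, leading to $\vartheta_k$ (so $\vartheta_0=\theta_T$), then $\|\vartheta_k-\theta^\star(1)\|_2\le(1-\gamma\Delta_{\min}/L)^{k/2}\,r/2$ and $E_1(\vartheta_k)-E_0(1)\le(1-\gamma\Delta_{\min}/L)^{k}\,\big(E_1(\theta_T)-E_0(1)\big)$. Here $E_1(\cdot)$ is the variational energy at $\lambda=1$ and $E_0(1)$ is the ground energy of $H(1)=H_{\rm f}$. *Option 1.* Put $T_1=\dfrac{2L_H\sqrt M\,\|H_{\rm f}-H_{\rm i}\|}{\gamma^2\Delta_{\min}^2}$ and $K_1=\dfrac{2L\ln2}{\gamma\Delta_{\min}}$. The run tracks the ground state for all integers $T\ge\max\{1,T_1\}$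 and $K\ge K_1$ (slices $\delta\lambda\propto\Delta_{\min}^2$, and $K\propto1/\Delta_{\min}$ steps per slice). Moreover, with $T=\max\{1,\lceil T_1\rceil\}$ there is an integer $K$, $0\le K\le K_1$, for which the run tracks the ground state and $$N_{\rm updates}=TK\le 384\ln2\;\frac{M^3\|H\|^2\|H_{\rm f}-H_{\rm i}\|}{\gamma^3\Delta_{\min}^3}.$$ *Option 2.* Put $T_2=\dfrac{4L_HL\sqrt M\,\|H_{\rm f}-H_{\rm i}\|}{\gamma^3\Delta_{\min}^3}$. With $K=1$ the run tracks the ground state for every integer $T\ge\max\{1,T_2\}$ (slices $\delta\lambda\propto\Delta_{\min}^3$). Moreover, with $K=1$ it tracks the ground state for some integer $T\ge1$ with $$N_{\rm updates}=T\le\max\Big\{1,\;384\,\frac{M^3\|H\|^2\|H_{\rm f}-H_{\rm i}\|}{\gamma^3\Delta_{\min}^3}\Big\}.$$ -/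

import Mathlib

noncomputable section

namespace AdiabaticVQE

/-- Computational basis labels of `n` qubits. -/
abbrev Bits (n : ℕ) : Type := Fin n → Fin 2

/-- The Hilbert space of `n` qubits. -/
abbrev QState (n : ℕ) : Type := EuclideanSpace ℂ (Bits n)

/-- Operators on the Hilbert space of `n` qubits; the norm is the operator norm. -/
abbrev QOp (n : ℕ) : Type := QState n →L[ℂ] QState n

/-- The parameter space `ℝ^M` with the Euclidean norm. -/
abbrev Param (M : ℕ) : Type := EuclideanSpace ℝ (Fin M)

/-! ### Pauli rotations and the ansatz -/

/-- Labels of the single-qubit Pauli matrices. -/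
inductive Pauli : Type
  | I
  | X
  | Y
  | Z

/-- The single-qubit Pauli matrices. -/
def Pauli.mat : Pauli → Matrix (Fin 2) (Fin 2) ℂ
  | Pauli.I => !![1, 0; 0, 1]
  | Pauli.X => !![0, 1; 1, 0]
  | Pauli.Y => !![0, -Complex.I; Complex.I, 0]
  | Pauli.Z => !![1, 0; 0, -1]

/-- The matrix of the Pauli string `s 0 ⊗ s 1 ⊗ ⋯ ⊗ s (n-1)`. -/
def pauliMatrix {n : ℕ} (s : Fin n → Pauli) : Matrix (Bits n) (Bits n) ℂ :=
  Matrix.of fun x y => ∏ i, (s i).mat (x i) (y i)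

/-- The Pauli string as an operator on the `n`-qubit Hilbert space. -/
def pauliOp {n : ℕ} (s : Fin n → Pauli) : QOp n :=
  Matrix.toEuclideanCLM (n := Bits n) (𝕜 := ℂ) (pauliMatrix s)

/-- The Pauli rotation `exp (-i t P)`. -/
def pauliRotation {n : ℕ} (s : Fin n → Pauli) (t : ℝ) : QOp n :=
  NormedSpace.exp ((-(Complex.I * (t : ℂ))) • pauliOp s)

/-- The reference state `|0…0⟩`. -/
def ketZero (n : ℕ) : QState n := EuclideanSpace.single (fun _ => 0) 1

/-- The ansatz state `ψ(θ) = U_{M-1} ⋯ U_1 U_0 |0⟩` with `U_j = exp (-i θ_j P_j)`. -/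
def ansatz {n M : ℕ} (P : Fin M → Fin n → Pauli) (θ : Param M) : QState n :=
  (((List.finRange M).reverse.map fun j => pauliRotation (P j) (θ j)).prod) (ketZero n)

/-- The partial derivative `∂_μ ψ(θ)`. -/
def dAnsatz {n M : ℕ} (P : Fin M → Fin n → Pauli) (θ : Param M) (μ : Fin M) : QState n :=
  fderiv ℝ (ansatz P) θ (EuclideanSpace.single μ 1)

/-- The geometric tensor
`g_{μν}(θ) = Re (⟨∂_μ ψ|∂_ν ψ⟩ - ⟨∂_μ ψ|ψ⟩ ⟨ψ|∂_ν ψ⟩)`. -/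
def geomTensor {n M : ℕ} (P : Fin M → Fin n → Pauli) (θ : Param M) :
    Matrix (Fin M) (Fin M) ℝ :=
  Matrix.of fun μ ν =>
    (inner ℂ (dAnsatz P θ μ) (dAnsatz P θ ν)
      - inner ℂ (dAnsatz P θ μ) (ansatz P θ) * inner ℂ (ansatz P θ) (dAnsatz P θ ν)).re

/-! ### The Hamiltonian path and its spectrum -/

/-- The interpolating Hamiltonian `H(lam) = (1 - lam) H_i + lam H_f`. -/
def ham {n : ℕ} (Hi Hf : QOp n) (lam : ℝ) : QOp n :=
  ((1 - lam : ℝ) : ℂ) • Hi + (lam : ℂ) • Hf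

/-- The ground energy `E_0`: the lowest eigenvalue of a self-adjoint operator. -/
def groundEnergy {n : ℕ} (A : QOp n) : ℝ := sInf (spectrum ℝ A)

/-- The energy `E_1` of the first excited level: the lowest eigenvalue above `E_0`. -/
def excitedEnergy {n : ℕ} (A : QOp n) : ℝ := sInf (spectrum ℝ A \ {groundEnergy A})

/-- The spectral gap `E_1 - E_0`. -/
def gap {n : ℕ} (A : QOp n) : ℝ := excitedEnergy A - groundEnergy A

/-- The ground energy is a simple eigenvalue. -/
def NondegenerateGround {n : ℕ} (A : QOp n) : Prop :=
  Module.finrank ℂ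
    (Module.End.eigenspace (A : QState n →ₗ[ℂ] QState n) ((groundEnergy A : ℝ) : ℂ)) = 1

/-- `v` is a (normalized) ground state of `A`. -/
def IsGroundState {n : ℕ} (A : QOp n) (v : QState n) : Prop :=
  ‖v‖ = 1 ∧ A v = ((groundEnergy A : ℝ) : ℂ) • v

/-- The minimum spectral gap along the path. -/
def minGap {n : ℕ} (Hi Hf : QOp n) : ℝ :=
  ⨅ lam : Set.Icc (0 : ℝ) 1, gap (ham Hi Hf lam)

/-- The bound `‖H‖` on the operator norm of the Hamiltonian along the path. -/
def pathNorm {n : ℕ} (Hi Hf : QOp n) : ℝ :=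
  ⨆ lam : Set.Icc (0 : ℝ) 1, ‖ham Hi Hf lam‖

/-! ### The variational energy and gradient descent -/

/-- The variational energy `⟨ψ(θ)|A|ψ(θ)⟩` of a Hamiltonian `A`. -/
def energy {n M : ℕ} (P : Fin M → Fin n → Pauli) (A : QOp n) (θ : Param M) : ℝ :=
  (inner ℂ (ansatz P θ) (A (ansatz P θ))).re

/-- One step of vanilla gradient descent with learning rate `η`. -/
def gdStep {n M : ℕ} (P : Fin M → Fin n → Pauli) (A : QOp n) (η : ℝ) (θ : Param M) : Param M :=
  θ - η • gradient (energy P A) θ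

/-- `k` steps of vanilla gradient descent on the energy of `H(lam)`, started at `θ`. -/
def descend {n M : ℕ} (P : Fin M → Fin n → Pauli) (Hi Hf : QOp n) (η lam : ℝ) (k : ℕ)
    (θ : Param M) : Param M :=
  (gdStep P (ham Hi Hf lam) η)^[k] θ

/-- The parameters after slice `t` of warm-started gradient descent with `T` slices
`lam_t = t / T`, `K` steps in each slice, learning rate `η` and starting point `θ₀`. -/
def warmStart {n M : ℕ} (P : Fin M → Fin n → Pauli) (Hi Hf : QOp n) (η : ℝ) (T K : ℕ)
    (θ₀ : Param M) : ℕ → Param M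
  | 0 => θ₀
  | t + 1 => descend P Hi Hf η (((t + 1 : ℕ) : ℝ) / T) K (warmStart P Hi Hf η T K θ₀ t)

/-- All energies `E_lam`, `lam ∈ [0,1]`, are `L`-smooth: their gradients are
`L`-Lipschitz. -/
def EnergySmooth {n M : ℕ} (P : Fin M → Fin n → Pauli) (Hi Hf : QOp n) (L : ℝ) : Prop :=
  ∀ lam ∈ Set.Icc (0 : ℝ) 1, ∀ θ θ' : Param M,
    ‖gradient (energy P (ham Hi Hf lam)) θ - gradient (energy P (ham Hi Hf lam)) θ'‖
      ≤ L * ‖θ - θ'‖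

/-- The Lipschitz constant `L_H = 24 ‖H‖ M^{3/2}` of the Hessian. -/
def hessLip {n : ℕ} (M : ℕ) (Hi Hf : QOp n) : ℝ :=
  24 * pathNorm Hi Hf * (M : ℝ) ^ (3 / 2 : ℝ)

/-- The Polyak–Łojasiewicz radius `r_PL = γ Δ_min / L_H`. -/
def plRadius {n : ℕ} (M : ℕ) (Hi Hf : QOp n) (γ : ℝ) : ℝ :=
  γ * minGap Hi Hf / hessLip M Hi Hf

/-- Warm-started gradient descent with `T` slices, `K` steps in each slice and learning rate
`1 / L`, started at `θs 0`, tracks the minimizers `θs` and reaches the last one: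
after each slice the distance is at most `r_PL / 2`; within each slice the iterates
start within `r_PL` of the new minimizer and approach it linearly; and after the last slice
continued descent on the final energy converges linearly, in parameters and in energy, to the
final ground state. -/
def TracksGroundState {n M : ℕ} (P : Fin M → Fin n → Pauli) (Hi Hf : QOp n) (γ : ℝ)
    (θs : ℝ → Param M) (L : ℝ) (T K : ℕ) : Prop :=
  (∀ t ≤ T, ‖warmStart P Hi Hf (1 / L) T K (θs 0) t - θs ((t : ℝ) / T)‖
      ≤ plRadius M Hi Hf γ / 2) ∧
  (∀ t < T, ∀ k ≤ K,
    ‖descend P Hi Hf (1 / L) (((t + 1 : ℕ) : ℝ) / T) k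
        (warmStart P Hi Hf (1 / L) T K (θs 0) t) - θs (((t + 1 : ℕ) : ℝ) / T)‖
      ≤ Real.sqrt (1 - γ * minGap Hi Hf / L) ^ k * plRadius M Hi Hf γ) ∧
  (∀ k : ℕ,
    ‖descend P Hi Hf (1 / L) 1 k (warmStart P Hi Hf (1 / L) T K (θs 0) T) - θs 1‖
        ≤ Real.sqrt (1 - γ * minGap Hi Hf / L) ^ k * (plRadius M Hi Hf γ / 2) ∧
    energy P (ham Hi Hf 1)
          (descend P Hi Hf (1 / L) 1 k (warmStart P Hi Hf (1 / L) T K (θs 0) T))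
        - groundEnergy (ham Hi Hf 1)
      ≤ (1 - γ * minGap Hi Hf / L) ^ k *
        (energy P (ham Hi Hf 1) (warmStart P Hi Hf (1 / L) T K (θs 0) T)
          - groundEnergy (ham Hi Hf 1)))

/-- The number of slices `1 / δlam = 2 L_H √M ‖H_f - H_i‖ / (γ² Δ_min²)` of the variant with
many steps per slice. -/
def slices₁ {n : ℕ} (M : ℕ) (Hi Hf : QOp n) (γ : ℝ) : ℝ :=
  2 * hessLip M Hi Hf * Real.sqrt M * ‖Hf - Hi‖ / (γ ^ 2 * minGap Hi Hf ^ 2)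

/-- The number of steps per slice `2 L ln 2 / (γ Δ_min)` of the variant with many steps per
slice. -/
def steps₁ {n : ℕ} (Hi Hf : QOp n) (γ L : ℝ) : ℝ :=
  2 * L * Real.log 2 / (γ * minGap Hi Hf)

/-- The number of slices `1 / δlam = 4 L_H L √M ‖H_f - H_i‖ / (γ³ Δ_min³)` of the variant with
one step per slice. -/
def slices₂ {n : ℕ} (M : ℕ) (Hi Hf : QOp n) (γ L : ℝ) : ℝ :=
  4 * hessLip M Hi Hf * L * Real.sqrt M * ‖Hf - Hi‖ / (γ ^ 3 * minGap Hi Hf ^ 3)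

end AdiabaticVQE

end

open AdiabaticVQE

/-!
Every Pauli rotation is `exp (-i t P) = cos t - i sin t P`, because `P² = 1`. Hence the ansatz moves
on a great circle in each parameter (`ansatz_add_shift`), and the energy obeys the parameter-shift
rule `∂_j E(θ) = E(θ + π/4 e_j) - E(θ - π/4 e_j)` (`hasShiftRule_energy`). The rule is inherited by
the partial derivatives, so `|E| ≤ ‖H‖` bounds the partial derivatives of order `1, 2, 3` by
`2 ‖H‖`, `4 ‖H‖`, `8 ‖H‖`. This gives the `4 M ‖H‖`-smoothness and a Hessian with Lipschitz constant
`8 ‖H‖ M^{3/2}`, a third of `L_H`.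

At a minimizer `H - E_0` annihilates the state, so the Hessian along `v` is
`2 ⟨∂_v ψ|(H - E_0)|∂_v ψ⟩`, which the spectral gap (`gap_mul_le`) and the geometric tensor bound
below by `2 γ Δ_min ‖v‖²` (`le_hessian_energy`). Within the radius `r = γ Δ_min / L_H` the Hessian is
then at least `(5/3) γ Δ_min`; it is symmetric and at most `L`, so one gradient step with learning
rate `1 / L` has derivative between `0` and `1 - (5/3) q`, `q = γ Δ_min / L`, and contracts distances
by that factor (`norm_gradientStep_sub_le`). Contraction in turn gives strong monotonicity of the
gradient, hence the Polyak–Łojasiewicz inequality and the linear decay of the energy.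

The gradients at two points of the path differ by at most `2 √M ‖H_f - H_i‖` times their distance.
Strong monotonicity on arbitrarily small balls turns this into the local speed bound
`√M ‖H_f - H_i‖ / (γ Δ_min)` for the minimizers, and a mean value inequality for continuous curves
makes it global (`norm_minimizer_sub_le`). Tracking is then an induction over slices
(`norm_warmStart_sub_le`).

The bounds on the number of updates hold for rounded numbers of slices and steps because the
contraction factor `1 - (5/3) q` is better than the required `(1 - q)^{1/2}`. With one step per slice,
half of the stated number of slices suffices, so the number can be rounded down. With many steps per
slice, rounding up the slices to `T` makes the shift per slice smaller by `x = T₁ / T`, and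
`⌊x K₁⌋` steps per slice suffice (`pow_floor_mul_le`).
-/

noncomputable section

namespace AdiabaticVQE

/-! ### Pauli rotations and the ansatz -/

theorem Pauli.mat_mul_self (p : Pauli) : p.mat * p.mat = 1 := by
  cases p <;> ext i j <;> fin_cases i <;> fin_cases j <;> simp [Pauli.mat, Matrix.mul_apply]

theorem Pauli.star_mat (p : Pauli) (a b : Fin 2) : star (p.mat a b) = p.mat b a := by
  cases p <;> fin_cases a <;> fin_cases b <;> simp [Pauli.mat]

theorem pauliMatrix_mul_self {n : ℕ} (s : Fin n → Pauli) : pauliMatrix s * pauliMatrix s = 1 := by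
  ext x y
  have h : ∀ i, ∑ z, (s i).mat (x i) z * (s i).mat z (y i) = if x i = y i then 1 else 0 := by
    intro i
    rw [← Matrix.mul_apply, Pauli.mat_mul_self, Matrix.one_apply]
  simp only [Matrix.mul_apply, pauliMatrix, Matrix.of_apply, ← Finset.prod_mul_distrib]
  rw [← Fintype.piFinset_univ, ← Finset.prod_univ_sum (fun _ => Finset.univ)
    (fun i z => (s i).mat (x i) z * (s i).mat z (y i)), Finset.prod_congr rfl fun i _ => h i,
    Matrix.one_apply]
  by_cases hxy : x = y
  · simp [hxy]
  · obtain ⟨i, hi⟩ := Function.ne_iff.1 hxy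
    rw [if_neg hxy]
    exact Finset.prod_eq_zero (Finset.mem_univ i) (if_neg hi)

theorem pauliOp_mul_self {n : ℕ} (s : Fin n → Pauli) : pauliOp s * pauliOp s = 1 := by
  rw [pauliOp, ← map_mul, pauliMatrix_mul_self, map_one]

theorem isSelfAdjoint_pauliOp {n : ℕ} (s : Fin n → Pauli) : IsSelfAdjoint (pauliOp s) := by
  rw [IsSelfAdjoint, pauliOp, ← map_star]
  congr 1
  ext x y
  simp only [Matrix.star_apply, pauliMatrix, Matrix.of_apply, star_prod, Pauli.star_mat]

/-- The exponential solves a linear differential equation in `z`: the derivative of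
`exp (z A) (cosh z - A sinh z)` vanishes because `A² = 1`. -/
theorem exp_smul_of_mul_self_eq_one {n : ℕ} {A : QOp n} (hA : A * A = 1) (z : ℂ) :
    NormedSpace.exp (z • A) = Complex.cosh z • (1 : QOp n) + Complex.sinh z • A := by
  have happ : ∀ v, A (A v) = v := fun v => by
    rw [← mul_apply_eq_comp, hA, one_apply_eq_self]
  let f : ℂ → QOp n := fun z =>
    NormedSpace.exp (z • A) * (Complex.cosh z • (1 : QOp n) - Complex.sinh z • A)
  have hf : ∀ z, HasDerivAt f 0 z := by
    intro z
    have h := (hasDerivAt_exp_smul_const A z).mul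
      (((Complex.hasDerivAt_cosh z).smul_const (1 : QOp n)).sub
        ((Complex.hasDerivAt_sinh z).smul_const A))
    refine h.congr_deriv ?_
    rw [mul_assoc, ← mul_add]
    convert mul_zero _
    refine ContinuousLinearMap.ext fun v => ?_
    simp [happ]
  have hc : f z = 1 := by
    rw [is_const_of_deriv_eq_zero (fun z => (hf z).differentiableAt) (fun z => (hf z).deriv) z 0]
    have h0 : (0 : ℂ) • A = 0 := ContinuousLinearMap.ext fun v => by simp
    simp [f, h0]
  have hinv : (Complex.cosh z • (1 : QOp n) - Complex.sinh z • A) *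
      (Complex.cosh z • (1 : QOp n) + Complex.sinh z • A) = 1 := by
    refine ContinuousLinearMap.ext fun v => ?_
    have h := Complex.cosh_sq_sub_sinh_sq z
    simp only [mul_apply_eq_comp, add_apply, sub_apply, smul_apply, one_apply_eq_self, map_add,
      map_smul, happ]
    conv_rhs => rw [← one_smul ℂ v, ← h]
    module
  calc NormedSpace.exp (z • A) = f z * (Complex.cosh z • (1 : QOp n) + Complex.sinh z • A) := by
        simp only [f]; rw [mul_assoc, hinv, mul_one]
    _ = _ := by rw [hc, one_mul]

theorem pauliRotation_eq {n : ℕ} (s : Fin n → Pauli) (t : ℝ) :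
    pauliRotation s t =
      ((Real.cos t : ℝ) : ℂ) • (1 : QOp n) - (Complex.I * (Real.sin t : ℝ)) • pauliOp s := by
  rw [pauliRotation, exp_smul_of_mul_self_eq_one (pauliOp_mul_self s), Complex.cosh_neg,
    Complex.sinh_neg, mul_comm Complex.I (t : ℂ), Complex.cosh_mul_I, Complex.sinh_mul_I]
  refine ContinuousLinearMap.ext fun v => ?_
  simp only [add_apply, sub_apply, smul_apply, one_apply_eq_self, Complex.ofReal_cos,
    Complex.ofReal_sin]
  module

theorem pauliRotation_add_apply {n : ℕ} (s : Fin n → Pauli) (t u : ℝ) (v : QState n) :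
    pauliRotation s (t + u) v =
      (Real.cos u : ℂ) • pauliRotation s t v
        + (Real.sin u : ℂ) • pauliRotation s (t + Real.pi / 2) v := by
  simp only [pauliRotation_eq, Real.cos_add, Real.sin_add, Real.cos_pi_div_two,
    Real.sin_pi_div_two, sub_apply, smul_apply, one_apply_eq_self]
  push_cast
  module

theorem norm_pauliRotation_apply {n : ℕ} (s : Fin n → Pauli) (t : ℝ) (v : QState n) :
    ‖pauliRotation s t v‖ = ‖v‖ := by
  have hadj : star (pauliRotation s t) = pauliRotation s (-t) := by
    rw [pauliRotation, pauliRotation, NormedSpace.star_exp, star_smul,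
      (isSelfAdjoint_pauliOp s).star_eq]
    simp
  have hmul : pauliRotation s (-t) * pauliRotation s t = 1 := by
    let _ : NormedAlgebra ℚ (QOp n) := NormedAlgebra.restrictScalars ℚ ℂ (QOp n)
    rw [pauliRotation, pauliRotation, ← NormedSpace.exp_add_of_commute]
    · have h0 : -(Complex.I * ((-t : ℝ) : ℂ)) • pauliOp s + -(Complex.I * (t : ℂ)) • pauliOp s = 0 :=
        ContinuousLinearMap.ext fun v => by simp
      rw [h0, NormedSpace.exp_zero]
    · exact ((Commute.refl _).smul_left _).smul_right _
  have h : inner ℂ (pauliRotation s t v) (pauliRotation s t v) = inner ℂ v v := by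
    rw [← ContinuousLinearMap.adjoint_inner_left, ← ContinuousLinearMap.star_eq_adjoint, hadj,
      ← mul_apply_eq_comp, hmul, one_apply_eq_self]
  rw [inner_self_eq_norm_sq_to_K, inner_self_eq_norm_sq_to_K] at h
  have h' : ‖pauliRotation s t v‖ ^ 2 = ‖v‖ ^ 2 := by exact_mod_cast h
  exact (sq_eq_sq₀ (norm_nonneg _) (norm_nonneg _)).1 h'

/-- The coordinate shift `t e_j` of the parameters. -/
abbrev shift {M : ℕ} (j : Fin M) (t : ℝ) : Param M := EuclideanSpace.single j t

/-- The product of the rotations whose indices are listed in `l`; the ansatz applies it to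
`|0…0⟩` with `l` the reversed list of all indices. -/
def circuit {n M : ℕ} (P : Fin M → Fin n → Pauli) (l : List (Fin M)) (θ : Param M) : QOp n :=
  (l.map fun j => pauliRotation (P j) (θ j)).prod

section circuit
variable {n M : ℕ} (P : Fin M → Fin n → Pauli)

theorem ansatz_eq_circuit (θ : Param M) :
    ansatz P θ = circuit P (List.finRange M).reverse θ (ketZero n) := rfl

theorem circuit_cons (j : Fin M) (l : List (Fin M)) (θ : Param M) :
    circuit P (j :: l) θ = pauliRotation (P j) (θ j) * circuit P l θ := by
  simp [circuit]

theorem norm_circuit_apply (l : List (Fin M)) (θ : Param M) (v : QState n) :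
    ‖circuit P l θ v‖ = ‖v‖ := by
  induction l with
  | nil => simp [circuit]
  | cons j l ih =>
    rw [circuit_cons, mul_apply_eq_comp, norm_pauliRotation_apply, ih]

theorem circuit_add_shift_of_notMem {l : List (Fin M)} {j : Fin M} (hj : j ∉ l) (θ : Param M)
    (t : ℝ) : circuit P l (θ + shift j t) = circuit P l θ := by
  unfold circuit
  congr 1
  refine List.map_congr_left fun i hi => ?_
  have : i ≠ j := fun h => hj (h ▸ hi)
  simp [this]

theorem circuit_add_shift_apply {l : List (Fin M)} (hl : l.Nodup) {j : Fin M} (hj : j ∈ l)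
    (θ : Param M) (t : ℝ) (v : QState n) :
    circuit P l (θ + shift j t) v =
      (Real.cos t : ℂ) • circuit P l θ v
        + (Real.sin t : ℂ) • circuit P l (θ + shift j (Real.pi / 2)) v := by
  induction l with
  | nil => simp at hj
  | cons i l ih =>
    rw [List.nodup_cons] at hl
    simp only [circuit_cons, mul_apply_eq_comp]
    by_cases hij : i = j
    · subst hij
      simp only [circuit_add_shift_of_notMem P hl.1, PiLp.add_apply, PiLp.single_apply,
        if_true]
      rw [pauliRotation_add_apply]
    · have hj' : j ∈ l := by
        rcases List.mem_cons.1 hj with h | h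
        · exact absurd h.symm hij
        · exact h
      simp only [PiLp.add_apply, PiLp.single_apply, hij, if_false, add_zero]
      rw [ih hl.2 hj', map_add, map_smul, map_smul]

theorem differentiable_circuit_apply (l : List (Fin M)) (v : QState n) :
    Differentiable ℝ fun θ : Param M => circuit P l θ v := by
  induction l with
  | nil => simp [circuit]
  | cons j l ih =>
    have h : (fun θ : Param M => circuit P (j :: l) θ v) = fun θ : Param M =>
        Real.cos (θ j) • circuit P l θ v
          - Real.sin (θ j) • ((Complex.I • pauliOp (P j)).restrictScalars ℝ) (circuit P l θ v) := by
      funext θ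
      simp only [circuit_cons, mul_apply_eq_comp, pauliRotation_eq,
        sub_apply, smul_apply,
        one_apply_eq_self, ContinuousLinearMap.coe_restrictScalars', Complex.coe_smul,
        mul_comm Complex.I, mul_smul]
    rw [h]
    fun_prop

theorem norm_ansatz (θ : Param M) : ‖ansatz P θ‖ = 1 := by
  rw [ansatz_eq_circuit, norm_circuit_apply, ketZero]
  simp

theorem differentiable_ansatz : Differentiable ℝ (ansatz P) :=
  differentiable_circuit_apply P _ _

/-- Each parameter enters through a single rotation, so the state moves on a great circle. -/
theorem ansatz_add_shift (θ : Param M) (j : Fin M) (t : ℝ) :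
    ansatz P (θ + shift j t) =
      Real.cos t • ansatz P θ + Real.sin t • ansatz P (θ + shift j (Real.pi / 2)) := by
  simp only [ansatz_eq_circuit]
  rw [circuit_add_shift_apply P (List.nodup_reverse.2 (List.nodup_finRange M))
    (List.mem_reverse.2 (List.mem_finRange j))]
  simp only [Complex.coe_smul]

theorem hasDerivAt_add_shift (θ : Param M) (j : Fin M) (t : ℝ) :
    HasDerivAt (fun t => θ + shift j t) (EuclideanSpace.single j 1) t := by
  have h : (fun t : ℝ => θ + shift j t) =
      fun t : ℝ => θ + t • (EuclideanSpace.single j 1 : Param M) := by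
    funext t
    ext i
    simp [PiLp.single_apply]
  rw [h]
  simpa using ((hasDerivAt_id t).smul_const (EuclideanSpace.single j 1 : Param M)).const_add θ

theorem hasDerivAt_comp_add_shift {F : Type*} [NormedAddCommGroup F] [NormedSpace ℝ F]
    {f : Param M → F} (hf : Differentiable ℝ f) (θ : Param M) (j : Fin M) :
    HasDerivAt (fun t => f (θ + shift j t)) (fderiv ℝ f θ (EuclideanSpace.single j 1)) 0 := by
  have h0 : θ + shift j (0 : ℝ) = θ := by ext i; simp
  have h1 : HasFDerivAt f (fderiv ℝ f θ) (θ + shift j (0 : ℝ)) := by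
    rw [h0]; exact (hf θ).hasFDerivAt
  exact h1.comp_hasDerivAt (0 : ℝ) (hasDerivAt_add_shift θ j 0)

theorem dAnsatz_eq (θ : Param M) (j : Fin M) :
    dAnsatz P θ j = ansatz P (θ + shift j (Real.pi / 2)) := by
  have h1 := hasDerivAt_comp_add_shift (differentiable_ansatz P) θ j
  have h2 : HasDerivAt (fun t => ansatz P (θ + shift j t))
      (ansatz P (θ + shift j (Real.pi / 2))) 0 := by
    rw [funext fun t => ansatz_add_shift P θ j t]
    refine (((Real.hasDerivAt_cos 0).smul_const (ansatz P θ)).add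
      ((Real.hasDerivAt_sin 0).smul_const
        (ansatz P (θ + shift j (Real.pi / 2))))).congr_deriv ?_
    rw [Real.sin_zero, Real.cos_zero, neg_zero, zero_smul, one_smul, zero_add]
  exact h1.unique h2

end circuit

/-! ### Functions obeying the parameter-shift rule -/

section shiftRule
variable {M : ℕ}

/-- The symmetric difference `F (θ + π/4 e_j) - F (θ - π/4 e_j)`. -/
def shiftDiff (j : Fin M) (F : Param M → ℝ) (θ : Param M) : ℝ :=
  F (θ + shift j (Real.pi / 4)) - F (θ + shift j (-(Real.pi / 4)))

/-- The parameter-shift rule: the partial derivatives of `F` are the symmetric differences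
`shiftDiff j F`. It is inherited by the partial derivatives, so a bound on `F` bounds all
derivatives of `F`. -/
structure HasShiftRule (F : Param M → ℝ) : Prop where
  differentiable : Differentiable ℝ F
  fderiv_single : ∀ θ j, fderiv ℝ F θ (EuclideanSpace.single j 1) = shiftDiff j F θ

theorem sum_abs_le_sqrt_mul_norm (v : Param M) : ∑ i, |v i| ≤ Real.sqrt M * ‖v‖ := by
  have h := Real.sum_mul_le_sqrt_mul_sqrt Finset.univ (fun _ : Fin M => (1 : ℝ)) fun i => |v i|
  simpa [EuclideanSpace.norm_eq] using h

theorem norm_le_sqrt_mul_of_abs_le {v : Param M} {c : ℝ} (hc : 0 ≤ c) (h : ∀ i, |v i| ≤ c) :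
    ‖v‖ ≤ Real.sqrt M * c := by
  rw [EuclideanSpace.norm_eq]
  refine Real.sqrt_le_iff.2 ⟨by positivity, ?_⟩
  calc ∑ i, ‖v i‖ ^ 2 ≤ ∑ _i : Fin M, c ^ 2 :=
        Finset.sum_le_sum fun i _ => by
          rw [Real.norm_eq_abs]; exact pow_le_pow_left₀ (abs_nonneg _) (h i) 2
    _ = (Real.sqrt M * c) ^ 2 := by
        rw [mul_pow, Real.sq_sqrt (Nat.cast_nonneg M)]; simp

theorem eq_sum_smul_single (v : Param M) :
    v = ∑ i, v i • (EuclideanSpace.single i 1 : Param M) := by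
  ext j
  simp [Pi.single_apply]

theorem abs_shiftDiff_le {F : Param M → ℝ} {B : ℝ} (hB : ∀ θ, |F θ| ≤ B) (j : Fin M)
    (θ : Param M) : |shiftDiff j F θ| ≤ 2 * B := by
  have h := abs_sub (F (θ + shift j (Real.pi / 4))) (F (θ + shift j (-(Real.pi / 4))))
  unfold shiftDiff
  linarith [hB (θ + shift j (Real.pi / 4)), hB (θ + shift j (-(Real.pi / 4)))]

theorem shiftDiff_comm (i j : Fin M) (F : Param M → ℝ) (θ : Param M) :
    shiftDiff i (shiftDiff j F) θ = shiftDiff j (shiftDiff i F) θ := by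
  simp only [shiftDiff, add_right_comm θ (shift j _) (shift i _)]
  ring

namespace HasShiftRule
variable {F : Param M → ℝ} {B : ℝ}

theorem shiftDiff (hF : HasShiftRule F) (j : Fin M) : HasShiftRule (shiftDiff j F) := by
  have hd : ∀ a : Param M, Differentiable ℝ fun θ => F (θ + a) := fun a =>
    hF.differentiable.comp (differentiable_id.add_const a)
  refine ⟨(hd _).sub (hd _), fun θ i => ?_⟩
  have h : fderiv ℝ (AdiabaticVQE.shiftDiff j F) θ
      = fderiv ℝ F (θ + shift j (Real.pi / 4)) - fderiv ℝ F (θ + shift j (-(Real.pi / 4))) := by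
    have := fderiv_sub (hd (shift j (Real.pi / 4)) θ) (hd (shift j (-(Real.pi / 4))) θ)
    rw [fderiv_comp_add_right, fderiv_comp_add_right] at this
    exact this
  rw [h, sub_apply, hF.fderiv_single, hF.fderiv_single, shiftDiff_comm]
  rfl

theorem fderiv_apply (hF : HasShiftRule F) (θ v : Param M) :
    fderiv ℝ F θ v = ∑ j, v j * AdiabaticVQE.shiftDiff j F θ := by
  conv_lhs => rw [eq_sum_smul_single v]
  simp [hF.fderiv_single]

theorem gradient_apply (hF : HasShiftRule F) (θ : Param M) (j : Fin M) :
    gradient F θ j = AdiabaticVQE.shiftDiff j F θ := by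
  have h := inner_gradient_left (𝕜 := ℝ) (f := F) (x := θ) (y := EuclideanSpace.single j 1)
  rw [hF.fderiv_single, EuclideanSpace.inner_single_right] at h
  simpa using h

theorem abs_sub_le (hF : HasShiftRule F) (hB : ∀ θ, |F θ| ≤ B) (θ θ' : Param M) :
    |F θ - F θ'| ≤ 2 * B * Real.sqrt M * ‖θ - θ'‖ := by
  have hB0 : 0 ≤ B := (abs_nonneg _).trans (hB 0)
  refine Convex.norm_image_sub_le_of_norm_fderiv_le (𝕜 := ℝ)
    (fun x _ => hF.differentiable x) (fun x _ => ?_) convex_univ (Set.mem_univ θ')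
    (Set.mem_univ θ)
  refine ContinuousLinearMap.opNorm_le_bound _ (by positivity) fun v => ?_
  rw [hF.fderiv_apply, Real.norm_eq_abs]
  calc |∑ j, v j * AdiabaticVQE.shiftDiff j F x|
      ≤ ∑ j, |v j| * (2 * B) := by
        refine (Finset.abs_sum_le_sum_abs _ _).trans (Finset.sum_le_sum fun j _ => ?_)
        rw [abs_mul]
        exact mul_le_mul_of_nonneg_left (abs_shiftDiff_le hB j x) (abs_nonneg _)
    _ ≤ (Real.sqrt M * ‖v‖) * (2 * B) := by
        rw [← Finset.sum_mul]
        exact mul_le_mul_of_nonneg_right (sum_abs_le_sqrt_mul_norm v) (by positivity)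
    _ = 2 * B * Real.sqrt M * ‖v‖ := by ring

theorem norm_gradient_le (hF : HasShiftRule F) (hB : ∀ θ, |F θ| ≤ B) (θ : Param M) :
    ‖gradient F θ‖ ≤ 2 * Real.sqrt M * B := by
  have hB0 : 0 ≤ B := (abs_nonneg _).trans (hB 0)
  refine (norm_le_sqrt_mul_of_abs_le (c := 2 * B) (by positivity) fun j => ?_).trans_eq (by ring)
  rw [hF.gradient_apply]
  exact abs_shiftDiff_le hB j θ

theorem norm_gradient_sub_le (hF : HasShiftRule F) (hB : ∀ θ, |F θ| ≤ B) (θ θ' : Param M) :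
    ‖gradient F θ - gradient F θ'‖ ≤ 4 * B * M * ‖θ - θ'‖ := by
  have hB0 : 0 ≤ B := (abs_nonneg _).trans (hB 0)
  refine (norm_le_sqrt_mul_of_abs_le (c := 2 * (2 * B) * Real.sqrt M * ‖θ - θ'‖) (by positivity)
    fun j => ?_).trans_eq ?_
  · rw [PiLp.sub_apply, hF.gradient_apply, hF.gradient_apply]
    exact (hF.shiftDiff j).abs_sub_le (abs_shiftDiff_le hB j) θ θ'
  · have h := Real.mul_self_sqrt (Nat.cast_nonneg (α := ℝ) M)
    linear_combination (4 * B * ‖θ - θ'‖) * h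

theorem differentiable_gradient (hF : HasShiftRule F) : Differentiable ℝ (gradient F) := by
  rw [differentiable_euclidean]
  intro j
  simp only [hF.gradient_apply]
  exact (hF.shiftDiff j).differentiable

/-- The Hessian as a bilinear form. -/
theorem inner_fderiv_gradient (hF : HasShiftRule F) (θ v w : Param M) :
    inner ℝ (fderiv ℝ (gradient F) θ v) w
      = ∑ i, ∑ j, v i * w j * AdiabaticVQE.shiftDiff i (AdiabaticVQE.shiftDiff j F) θ := by
  have h : ∀ j, (fderiv ℝ (gradient F) θ v) j = fderiv ℝ (AdiabaticVQE.shiftDiff j F) θ v := by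
    intro j
    have h1 := ((EuclideanSpace.proj j : Param M →L[ℝ] ℝ)).hasFDerivAt.comp θ
      (hF.differentiable_gradient θ).hasFDerivAt
    have h2 : (EuclideanSpace.proj j : Param M →L[ℝ] ℝ) ∘ gradient F
        = AdiabaticVQE.shiftDiff j F :=
      funext fun x => hF.gradient_apply x j
    rw [h2] at h1
    rw [h1.fderiv]
    rfl
  rw [PiLp.inner_apply, Finset.sum_comm]
  refine Finset.sum_congr rfl fun j _ => ?_
  rw [h, (hF.shiftDiff j).fderiv_apply]
  simp only [RCLike.inner_apply, conj_trivial, Finset.mul_sum]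
  exact Finset.sum_congr rfl fun i _ => by ring

theorem fderiv_gradient_symm (hF : HasShiftRule F) (θ v w : Param M) :
    inner ℝ (fderiv ℝ (gradient F) θ v) w = inner ℝ v (fderiv ℝ (gradient F) θ w) := by
  rw [real_inner_comm _ v, hF.inner_fderiv_gradient, hF.inner_fderiv_gradient, Finset.sum_comm]
  refine Finset.sum_congr rfl fun j _ => Finset.sum_congr rfl fun i _ => ?_
  rw [shiftDiff_comm]
  ring

/-- The Hessian is `8 B M^{3/2}`-Lipschitz, as third partial derivatives are at most `8 B`. -/
theorem abs_hessian_sub_le (hF : HasShiftRule F) (hB : ∀ θ, |F θ| ≤ B) (θ θ' v : Param M) :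
    |inner ℝ (fderiv ℝ (gradient F) θ v) v - inner ℝ (fderiv ℝ (gradient F) θ' v) v|
      ≤ 8 * B * (M : ℝ) ^ (3 / 2 : ℝ) * ‖θ - θ'‖ * ‖v‖ ^ 2 := by
  have hB0 : 0 ≤ B := (abs_nonneg _).trans (hB 0)
  have hM : (M : ℝ) ^ (3 / 2 : ℝ) = Real.sqrt M * (Real.sqrt M * Real.sqrt M) := by
    rw [Real.sqrt_eq_rpow]
    rcases Nat.eq_zero_or_pos M with rfl | hM
    · norm_num
    · have : (0 : ℝ) < M := by exact_mod_cast hM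
      rw [← Real.rpow_add this, ← Real.rpow_add this]
      norm_num
  rw [hF.inner_fderiv_gradient, hF.inner_fderiv_gradient, ← Finset.sum_sub_distrib]
  simp only [← Finset.sum_sub_distrib, ← mul_sub]
  set c := 2 * (2 * (2 * B)) * Real.sqrt M * ‖θ - θ'‖ with hc
  have hc0 : 0 ≤ c := by positivity
  calc _ ≤ ∑ i, ∑ j, |v i| * |v j| * c := by
        refine (Finset.abs_sum_le_sum_abs _ _).trans (Finset.sum_le_sum fun i _ => ?_)
        refine (Finset.abs_sum_le_sum_abs _ _).trans (Finset.sum_le_sum fun j _ => ?_)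
        rw [abs_mul, abs_mul]
        exact mul_le_mul_of_nonneg_left (((hF.shiftDiff j).shiftDiff i).abs_sub_le
          (abs_shiftDiff_le (abs_shiftDiff_le hB j) i) θ θ') (by positivity)
    _ = (∑ i, |v i|) * (∑ j, |v j|) * c := by
        rw [Finset.sum_mul_sum, Finset.sum_mul]
        exact Finset.sum_congr rfl fun i _ => by rw [Finset.sum_mul]
    _ ≤ (Real.sqrt M * ‖v‖) * (Real.sqrt M * ‖v‖) * c := by
        have := sum_abs_le_sqrt_mul_norm v
        gcongr
    _ = _ := by rw [hM, hc]; ring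

end HasShiftRule
end shiftRule

/-! ### The variational energy -/

section energy
variable {n M : ℕ} (P : Fin M → Fin n → Pauli) (A : QOp n)

theorem abs_energy_le (θ : Param M) : |energy P A θ| ≤ ‖A‖ := by
  have h1 : ‖A (ansatz P θ)‖ ≤ ‖A‖ := by simpa [norm_ansatz] using A.le_opNorm (ansatz P θ)
  calc |energy P A θ| ≤ ‖inner ℂ (ansatz P θ) (A (ansatz P θ))‖ := Complex.abs_re_le_norm _
    _ ≤ ‖ansatz P θ‖ * ‖A (ansatz P θ)‖ := norm_inner_le_norm _ _
    _ ≤ ‖A‖ := by rw [norm_ansatz, one_mul]; exact h1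

theorem energy_add_shift (θ : Param M) (j : Fin M) (t : ℝ) :
    energy P A (θ + shift j t) =
      Real.cos t ^ 2 * energy P A θ + Real.sin t ^ 2 * energy P A (θ + shift j (Real.pi / 2))
        + Real.cos t * Real.sin t *
          ((inner ℂ (ansatz P θ) (A (dAnsatz P θ j))).re
            + (inner ℂ (dAnsatz P θ j) (A (ansatz P θ))).re) := by
  simp only [energy, dAnsatz_eq]
  rw [ansatz_add_shift]
  simp only [← Complex.coe_smul, map_add, map_smul, inner_add_left, inner_add_right,
    inner_smul_left, inner_smul_right, Complex.conj_ofReal, Complex.add_re, Complex.re_ofReal_mul]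
  ring

theorem shiftDiff_energy (θ : Param M) (j : Fin M) :
    shiftDiff j (energy P A) θ =
      (inner ℂ (ansatz P θ) (A (dAnsatz P θ j))).re
        + (inner ℂ (dAnsatz P θ j) (A (ansatz P θ))).re := by
  have h2 : Real.sqrt 2 ^ 2 = 2 := Real.sq_sqrt (by norm_num)
  rw [shiftDiff, energy_add_shift P A θ j (Real.pi / 4), energy_add_shift P A θ j (-(Real.pi / 4)),
    Real.cos_neg, Real.sin_neg, Real.cos_pi_div_four, Real.sin_pi_div_four]
  linear_combination (1 / 2 * ((inner ℂ (ansatz P θ) (A (dAnsatz P θ j))).re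
        + (inner ℂ (dAnsatz P θ j) (A (ansatz P θ))).re)) * h2

theorem differentiable_energy : Differentiable ℝ (energy P A) := by
  have h1 := differentiable_ansatz P
  have h2 : Differentiable ℝ fun θ => A (ansatz P θ) :=
    (A.restrictScalars ℝ).differentiable.comp h1
  exact Complex.reCLM.differentiable.comp (h1.inner ℂ h2)

theorem hasShiftRule_energy : HasShiftRule (energy P A) := by
  refine ⟨differentiable_energy P A, fun θ j => ?_⟩
  refine (hasDerivAt_comp_add_shift (differentiable_energy P A) θ j).unique ?_
  rw [funext fun t => energy_add_shift P A θ j t, shiftDiff_energy]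
  have hc := Real.hasDerivAt_cos 0
  have hs := Real.hasDerivAt_sin 0
  refine (((hc.pow 2).mul_const _).add ((hs.pow 2).mul_const _)).add
    ((hc.mul hs).mul_const _) |>.congr_deriv ?_
  simp only [Real.sin_zero, Real.cos_zero]
  ring

end energy

/-! ### The spectral gap -/

section gap
variable {n : ℕ}

theorem abs_le_norm_of_mem_spectrum {A : QOp n} {x : ℝ} (hx : x ∈ spectrum ℝ A) : |x| ≤ ‖A‖ := by
  have : Nontrivial (QState n) := inferInstance
  simpa using spectrum.subset_closedBall_norm A hx

theorem abs_sInf_le_norm {A : QOp n} {S : Set ℝ} (hS : S ⊆ spectrum ℝ A) : |sInf S| ≤ ‖A‖ := by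
  rcases S.eq_empty_or_nonempty with rfl | ⟨x, hx⟩
  · simp
  · have hb : ∀ y ∈ S, -‖A‖ ≤ y := fun y hy => (abs_le.1 (abs_le_norm_of_mem_spectrum (hS hy))).1
    exact abs_le.2 ⟨le_csInf ⟨x, hx⟩ hb, (csInf_le ⟨_, hb⟩ hx).trans
      (abs_le.1 (abs_le_norm_of_mem_spectrum (hS hx))).2⟩

theorem neg_two_mul_norm_le_gap (A : QOp n) : -(2 * ‖A‖) ≤ gap A := by
  have h1 := abs_le.1 (abs_sInf_le_norm (A := A) (S := spectrum ℝ A \ {groundEnergy A})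
    Set.sdiff_subset)
  have h2 := abs_le.1 (abs_sInf_le_norm (A := A) (S := spectrum ℝ A) subset_rfl)
  have e1 : excitedEnergy A = sInf (spectrum ℝ A \ {groundEnergy A}) := rfl
  have e2 : groundEnergy A = sInf (spectrum ℝ A) := rfl
  rw [gap]
  linarith [h1.1, h2.2]

theorem mem_spectrum_of_apply_eq {A : QOp n} {x : ℝ} {v : QState n} (hv : v ≠ 0)
    (h : A v = (x : ℂ) • v) : x ∈ spectrum ℝ A := by
  rw [spectrum.mem_iff]
  rintro ⟨u, hu⟩
  apply hv
  have h0 : (u : QOp n) v = 0 := by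
    rw [hu, Algebra.algebraMap_eq_smul_one, sub_apply, h]
    simp
  calc v = ((u⁻¹ : (QOp n)ˣ) * u : QOp n) v := by rw [Units.inv_mul, one_apply_eq_self]
    _ = 0 := by rw [mul_apply_eq_comp, h0, map_zero]

theorem inner_apply_eq_of_isSelfAdjoint {A : QOp n} (hA : IsSelfAdjoint A) (v w : QState n) :
    inner ℂ v (A w) = inner ℂ (A v) w := by
  rw [← ContinuousLinearMap.adjoint_inner_left, hA.adjoint_eq]

/-- The excess energy of `w` over the ground level is at least the gap times the squared norm of
the component of `w` orthogonal to the ground state. -/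
theorem gap_mul_le {A : QOp n} (hA : IsSelfAdjoint A) (hnd : NondegenerateGround A)
    {ψ : QState n} (hψ : IsGroundState A ψ) (w : QState n) :
    gap A * (‖w‖ ^ 2 - ‖inner ℂ ψ w‖ ^ 2)
      ≤ (inner ℂ w (A w)).re - groundEnergy A * ‖w‖ ^ 2 := by
  obtain ⟨hψ1, hψA⟩ := hψ
  have hψψ : inner ℂ ψ ψ = (1 : ℂ) := by rw [inner_self_eq_norm_sq_to_K, hψ1]; simp
  set a : ℂ := inner ℂ ψ w with ha
  set u : QState n := w - a • ψ with hu
  have hψu : inner ℂ ψ u = (0 : ℂ) := by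
    rw [hu, inner_sub_right, inner_smul_right, hψψ, ← ha]; simp
  have huψ : inner ℂ u ψ = (0 : ℂ) := by rw [← inner_conj_symm, hψu, map_zero]
  have hw : w = a • ψ + u := by rw [hu]; abel
  have haa : (starRingEnd ℂ a * a).re = ‖a‖ ^ 2 := by
    rw [← Complex.normSq_eq_conj_mul_self, Complex.ofReal_re, Complex.normSq_eq_norm_sq]
  have hnw : ‖w‖ ^ 2 = ‖a‖ ^ 2 + ‖u‖ ^ 2 := by
    have h : inner ℂ w w = starRingEnd ℂ a * a + inner ℂ u u := by
      rw [hw]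
      simp only [inner_add_left, inner_add_right, inner_smul_left, inner_smul_right, hψψ, hψu, huψ]
      ring
    have h' := congrArg Complex.re h
    rw [Complex.add_re, haa] at h'
    simpa [inner_self_eq_norm_sq_to_K, ← Complex.ofReal_pow] using h'
  have hAw : (inner ℂ w (A w)).re = groundEnergy A * ‖a‖ ^ 2 + (inner ℂ u (A u)).re := by
    have hψAu : inner ℂ ψ (A u) = (0 : ℂ) := by
      rw [inner_apply_eq_of_isSelfAdjoint hA, hψA, inner_smul_left, hψu, mul_zero]
    have h : inner ℂ w (A w)
        = ((groundEnergy A : ℝ) : ℂ) * (starRingEnd ℂ a * a) + inner ℂ u (A u) := by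
      rw [hw]
      simp only [map_add, map_smul, inner_add_left, inner_add_right, inner_smul_left,
        inner_smul_right, hψψ, hψAu, hψA, huψ]
      ring
    rw [h, Complex.add_re, Complex.re_ofReal_mul, haa]
  suffices hmain : excitedEnergy A * ‖u‖ ^ 2 ≤ (inner ℂ u (A u)).re by
    rw [hAw, hnw, gap]
    nlinarith
  have hsym : (A : QState n →ₗ[ℂ] QState n).IsSymmetric := hA.isSymmetric
  set b := hsym.eigenvectorBasis rfl with hb
  set ev := hsym.eigenvalues rfl with hev
  have hAb : ∀ i, A (b i) = ((ev i : ℝ) : ℂ) • b i := fun i =>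
    hsym.apply_eigenvectorBasis rfl i
  have hspec : ∀ i, ev i ∈ spectrum ℝ A := fun i =>
    mem_spectrum_of_apply_eq (b.orthonormal.ne_zero i) (hAb i)
  have hterm : ∀ i, excitedEnergy A * ‖inner ℂ (b i) u‖ ^ 2 ≤ ev i * ‖inner ℂ (b i) u‖ ^ 2 := by
    intro i
    by_cases hi : ev i = groundEnergy A
    · -- the ground level is spanned by `ψ`, to which `u` is orthogonal
      have hψne : (⟨ψ, by
          rw [Module.End.mem_eigenspace_iff]; exact hψA⟩ : Module.End.eigenspace
            (A : QState n →ₗ[ℂ] QState n) ((groundEnergy A : ℝ) : ℂ)) ≠ 0 := by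
        intro h
        have : ψ = 0 := congrArg Subtype.val h
        rw [this] at hψ1
        simp at hψ1
      obtain ⟨c, hc⟩ := (finrank_eq_one_iff_of_nonzero' _ hψne).1 hnd
        ⟨b i, by rw [Module.End.mem_eigenspace_iff, ← hi]; exact hAb i⟩
      have hc' : c • ψ = b i := congrArg Subtype.val hc
      rw [← hc', inner_smul_left, hψu]
      simp
    · refine mul_le_mul_of_nonneg_right (csInf_le ⟨-‖A‖, fun y hy => ?_⟩ ⟨hspec i, hi⟩)
        (by positivity)
      exact (abs_le.1 (abs_le_norm_of_mem_spectrum hy.1)).1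
  have h1 : ‖u‖ ^ 2 = ∑ i, ‖inner ℂ (b i) u‖ ^ 2 := (b.sum_sq_norm_inner_right u).symm
  have h2 : (inner ℂ u (A u)).re = ∑ i, ev i * ‖inner ℂ (b i) u‖ ^ 2 := by
    rw [← b.sum_inner_mul_inner u (A u), Complex.re_sum]
    refine Finset.sum_congr rfl fun i _ => ?_
    rw [inner_apply_eq_of_isSelfAdjoint hA, hAb, inner_smul_left, Complex.conj_ofReal,
      mul_left_comm, Complex.re_ofReal_mul, ← inner_conj_symm u, ← Complex.normSq_eq_conj_mul_self,
      Complex.ofReal_re, Complex.normSq_eq_norm_sq]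
  rw [h1, h2, Finset.mul_sum]
  exact Finset.sum_le_sum fun i _ => hterm i

end gap

/-! ### The Hamiltonian path -/

section path
variable {n M : ℕ} (P : Fin M → Fin n → Pauli) (Hi Hf : QOp n)

theorem norm_ham_le {lam : ℝ} (h : lam ∈ Set.Icc (0 : ℝ) 1) :
    ‖ham Hi Hf lam‖ ≤ ‖Hi‖ + ‖Hf‖ := by
  have h1 : ‖((1 - lam : ℝ) : ℂ) • Hi‖ ≤ ‖Hi‖ := by
    rw [norm_smul, Complex.norm_real, Real.norm_of_nonneg (by linarith [h.2])]
    exact mul_le_of_le_one_left (norm_nonneg _) (by linarith [h.1])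
  have h2 : ‖(lam : ℂ) • Hf‖ ≤ ‖Hf‖ := by
    rw [norm_smul, Complex.norm_real, Real.norm_of_nonneg h.1]
    exact mul_le_of_le_one_left (norm_nonneg _) h.2
  exact (norm_add_le _ _).trans (add_le_add h1 h2)

theorem norm_ham_le_pathNorm {lam : ℝ} (h : lam ∈ Set.Icc (0 : ℝ) 1) :
    ‖ham Hi Hf lam‖ ≤ pathNorm Hi Hf := by
  refine le_ciSup (f := fun lam : Set.Icc (0 : ℝ) 1 => ‖ham Hi Hf lam‖)
    ⟨‖Hi‖ + ‖Hf‖, ?_⟩ ⟨lam, h⟩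
  rintro _ ⟨x, rfl⟩
  exact norm_ham_le Hi Hf x.2

theorem minGap_le_gap {lam : ℝ} (h : lam ∈ Set.Icc (0 : ℝ) 1) :
    minGap Hi Hf ≤ gap (ham Hi Hf lam) := by
  refine ciInf_le (f := fun lam : Set.Icc (0 : ℝ) 1 => gap (ham Hi Hf lam))
    ⟨-(2 * (‖Hi‖ + ‖Hf‖)), ?_⟩ ⟨lam, h⟩
  rintro _ ⟨x, rfl⟩
  have h1 := neg_two_mul_norm_le_gap (ham Hi Hf x)
  have h2 := norm_ham_le Hi Hf x.2
  simp only
  linarith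

variable {Hi Hf} in
theorem isSelfAdjoint_ham (hHi : IsSelfAdjoint Hi) (hHf : IsSelfAdjoint Hf) (lam : ℝ) :
    IsSelfAdjoint (ham Hi Hf lam) := by
  refine ContinuousLinearMap.isSelfAdjoint_iff_isSymmetric.2 fun v w => ?_
  simp only [ContinuousLinearMap.coe_coe, ham, add_apply, smul_apply, inner_add_left,
    inner_add_right, inner_smul_left, inner_smul_right, Complex.conj_ofReal,
    inner_apply_eq_of_isSelfAdjoint hHi, inner_apply_eq_of_isSelfAdjoint hHf]

theorem energy_ham_sub (a b : ℝ) (θ : Param M) :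
    energy P (ham Hi Hf a) θ - energy P (ham Hi Hf b) θ = (a - b) * energy P (Hf - Hi) θ := by
  simp only [energy, ham, add_apply, sub_apply, smul_apply, inner_add_right, inner_sub_right,
    inner_smul_right, Complex.add_re, Complex.sub_re, Complex.re_ofReal_mul]
  ring

/-- The energy gradients at two points of the path differ by at most `2 √M ‖H_f - H_i‖` times
the distance of the points. -/
theorem norm_gradient_ham_sub_le (a b : ℝ) (θ : Param M) :
    ‖gradient (energy P (ham Hi Hf a)) θ - gradient (energy P (ham Hi Hf b)) θ‖
      ≤ 2 * Real.sqrt M * ‖Hf - Hi‖ * |a - b| := by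
  have h : gradient (energy P (ham Hi Hf a)) θ - gradient (energy P (ham Hi Hf b)) θ
      = (a - b) • gradient (energy P (Hf - Hi)) θ := by
    ext j
    have := energy_ham_sub P Hi Hf a b (θ + shift j (Real.pi / 4))
    have := energy_ham_sub P Hi Hf a b (θ + shift j (-(Real.pi / 4)))
    simp only [PiLp.sub_apply, PiLp.smul_apply, (hasShiftRule_energy P _).gradient_apply,
      shiftDiff, smul_eq_mul]
    linarith
  rw [h, norm_smul, Real.norm_eq_abs, mul_comm]
  exact mul_le_mul_of_nonneg_right
    ((hasShiftRule_energy P _).norm_gradient_le (abs_energy_le P _) θ) (abs_nonneg _)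

end path

/-! ### Gradient and Hessian at a ground state -/

section hessian
variable {n M : ℕ} (P : Fin M → Fin n → Pauli) {A : QOp n}

theorem energy_sub_smul_one (c : ℝ) (θ : Param M) :
    energy P (A - (c : ℂ) • 1) θ = energy P A θ - c := by
  have h : inner ℂ (ansatz P θ) (ansatz P θ) = (1 : ℂ) := by
    rw [inner_self_eq_norm_sq_to_K, norm_ansatz]; simp
  rw [energy, energy, sub_apply, smul_apply, one_apply_eq_self, inner_sub_right,
    inner_smul_right, h, mul_one, Complex.sub_re, Complex.ofReal_re]

theorem gradient_energy_sub_smul_one (c : ℝ) :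
    gradient (energy P (A - (c : ℂ) • 1)) = gradient (energy P A) := by
  funext θ
  ext j
  simp only [(hasShiftRule_energy P _).gradient_apply, shiftDiff, energy_sub_smul_one]
  ring

theorem isSelfAdjoint_sub_smul_one (hA : IsSelfAdjoint A) (c : ℝ) :
    IsSelfAdjoint (A - (c : ℂ) • (1 : QOp n)) := by
  refine ContinuousLinearMap.isSelfAdjoint_iff_isSymmetric.2 fun v w => ?_
  simp only [ContinuousLinearMap.coe_coe, sub_apply, smul_apply, one_apply_eq_self,
    inner_sub_left, inner_sub_right, inner_smul_left, inner_smul_right, Complex.conj_ofReal,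
    inner_apply_eq_of_isSelfAdjoint hA]

theorem energy_eq_groundEnergy {θ : Param M} (hψ : IsGroundState A (ansatz P θ)) :
    energy P A θ = groundEnergy A := by
  rw [energy, hψ.2, inner_smul_right, Complex.re_ofReal_mul, inner_self_eq_norm_sq_to_K, hψ.1]
  simp

theorem fderiv_ansatz_apply (θ v : Param M) :
    fderiv ℝ (ansatz P) θ v = ∑ j, v j • dAnsatz P θ j := by
  conv_lhs => rw [eq_sum_smul_single v]
  rw [map_sum]
  exact Finset.sum_congr rfl fun j _ => by rw [map_smul]; rfl

theorem inner_gradient_energy (hA : IsSelfAdjoint A) (θ v : Param M) :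
    inner ℝ (gradient (energy P A) θ) v
      = 2 * (inner ℂ (A (ansatz P θ)) (fderiv ℝ (ansatz P) θ v)).re := by
  rw [inner_gradient_left, (hasShiftRule_energy P A).fderiv_apply, fderiv_ansatz_apply, inner_sum,
    Complex.re_sum, Finset.mul_sum]
  refine Finset.sum_congr rfl fun j _ => ?_
  rw [shiftDiff_energy, inner_apply_eq_of_isSelfAdjoint hA, ← Complex.coe_smul, inner_smul_right,
    Complex.re_ofReal_mul, ← inner_conj_symm (dAnsatz P θ j), Complex.conj_re]
  ring

theorem sub_smul_one_apply_eq_zero {ψ : QState n} (hψ : IsGroundState A ψ) :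
    (A - ((groundEnergy A : ℝ) : ℂ) • (1 : QOp n)) ψ = 0 := by
  simp [hψ.2]

theorem gradient_energy_eq_zero (hA : IsSelfAdjoint A) {θ : Param M}
    (hψ : IsGroundState A (ansatz P θ)) : gradient (energy P A) θ = 0 := by
  refine ext_inner_right ℝ fun v => ?_
  rw [← gradient_energy_sub_smul_one P (groundEnergy A),
    inner_gradient_energy P (isSelfAdjoint_sub_smul_one hA _), sub_smul_one_apply_eq_zero hψ]
  simp

/-- At a ground state the second derivatives of the ansatz do not contribute to the Hessian,
because `A - E_0` annihilates the state. -/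
theorem hessian_energy_eq (hA : IsSelfAdjoint A) {θ : Param M}
    (hψ : IsGroundState A (ansatz P θ)) (v : Param M) :
    inner ℝ (fderiv ℝ (gradient (energy P A)) θ v) v
      = 2 * ((inner ℂ (fderiv ℝ (ansatz P) θ v) (A (fderiv ℝ (ansatz P) θ v))).re
        - groundEnergy A * ‖fderiv ℝ (ansatz P) θ v‖ ^ 2) := by
  set B : QOp n := A - ((groundEnergy A : ℝ) : ℂ) • 1 with hB
  have hBsa : IsSelfAdjoint B := isSelfAdjoint_sub_smul_one hA _
  have hBψ : B (ansatz P θ) = 0 := sub_smul_one_apply_eq_zero hψ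
  rw [← gradient_energy_sub_smul_one P (groundEnergy A), ← hB]
  have hdw : Differentiable ℝ fun x => fderiv ℝ (ansatz P) x v := by
    have h : (fun x => fderiv ℝ (ansatz P) x v)
        = fun x => ∑ j, v j • ansatz P (x + shift j (Real.pi / 2)) := by
      funext x
      rw [fderiv_ansatz_apply]
      exact Finset.sum_congr rfl fun j _ => by rw [dAnsatz_eq]
    rw [h]
    have := differentiable_ansatz P
    fun_prop
  have h1 : HasFDerivAt (fun x => inner ℝ (gradient (energy P B) x) v)
      ((innerSL ℝ v).comp (fderiv ℝ (gradient (energy P B)) θ)) θ := by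
    have h := (innerSL ℝ v).hasFDerivAt.comp θ
      ((hasShiftRule_energy P B).differentiable_gradient θ).hasFDerivAt
    refine h.congr_of_eventuallyEq (Filter.Eventually.of_forall fun x => ?_)
    simp
  have hB' : HasFDerivAt (fun x => B (ansatz P x))
      ((B.restrictScalars ℝ).comp (fderiv ℝ (ansatz P) θ)) θ :=
    (B.restrictScalars ℝ).hasFDerivAt.comp θ (differentiable_ansatz P θ).hasFDerivAt
  have h2 := (Complex.reCLM.hasFDerivAt.comp θ (hB'.inner ℂ (hdw θ).hasFDerivAt)).const_mul 2
  have h3 := congrArg (fun T : Param M →L[ℝ] ℝ => T v)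
    (h1.unique (h2.congr_of_eventuallyEq (Filter.Eventually.of_forall fun x =>
      inner_gradient_energy P hBsa x v)))
  simp only [ContinuousLinearMap.comp_apply, innerSL_apply_apply, smul_apply,
    fderivInnerCLM_apply, ContinuousLinearMap.prod_apply, hBψ, inner_zero_left, zero_add,
    Complex.reCLM_apply, ContinuousLinearMap.coe_restrictScalars', smul_eq_mul] at h3
  rw [real_inner_comm, h3, ← inner_apply_eq_of_isSelfAdjoint hBsa, hB, sub_apply,
    smul_apply, one_apply_eq_self, inner_sub_right, inner_smul_right, Complex.sub_re,
    Complex.re_ofReal_mul, inner_self_eq_norm_sq_to_K]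
  simp [← Complex.ofReal_pow]

theorem geomTensor_quadratic (θ v : Param M) :
    ∑ i, ∑ j, v i * v j * geomTensor P θ i j
      = ‖fderiv ℝ (ansatz P) θ v‖ ^ 2
        - ‖inner ℂ (ansatz P θ) (fderiv ℝ (ansatz P) θ v)‖ ^ 2 := by
  set w := fderiv ℝ (ansatz P) θ v with hw
  have hws : w = ∑ j, (v j : ℂ) • dAnsatz P θ j := by
    rw [hw, fderiv_ansatz_apply]; simp only [Complex.coe_smul]
  have h1 : inner ℂ w w = ∑ i, ∑ j, (v i : ℂ) * (v j : ℂ) *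
      inner ℂ (dAnsatz P θ i) (dAnsatz P θ j) := by
    rw [hws, sum_inner]
    refine Finset.sum_congr rfl fun i _ => ?_
    rw [inner_sum]
    refine Finset.sum_congr rfl fun j _ => ?_
    rw [inner_smul_left, inner_smul_right, Complex.conj_ofReal]
    ring
  have h2 : inner ℂ w (ansatz P θ) * inner ℂ (ansatz P θ) w = ∑ i, ∑ j, (v i : ℂ) * (v j : ℂ) *
      (inner ℂ (dAnsatz P θ i) (ansatz P θ) * inner ℂ (ansatz P θ) (dAnsatz P θ j)) := by
    rw [hws, sum_inner, inner_sum, Finset.sum_mul_sum]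
    refine Finset.sum_congr rfl fun i _ => Finset.sum_congr rfl fun j _ => ?_
    rw [inner_smul_left, inner_smul_right, Complex.conj_ofReal]
    ring
  have h3 : ‖w‖ ^ 2 = (inner ℂ w w).re := by
    rw [inner_self_eq_norm_sq_to_K]; simp [← Complex.ofReal_pow]
  have h4 : ‖inner ℂ (ansatz P θ) w‖ ^ 2
      = (inner ℂ w (ansatz P θ) * inner ℂ (ansatz P θ) w).re := by
    rw [← inner_conj_symm w, ← Complex.normSq_eq_conj_mul_self, Complex.ofReal_re,
      Complex.normSq_eq_norm_sq]
  rw [h3, h4, ← Complex.sub_re, h1, h2, ← Finset.sum_sub_distrib, Complex.re_sum]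
  refine Finset.sum_congr rfl fun i _ => ?_
  rw [← Finset.sum_sub_distrib, Complex.re_sum]
  refine Finset.sum_congr rfl fun j _ => ?_
  rw [← mul_sub, ← Complex.ofReal_mul, Complex.re_ofReal_mul]
  rfl

theorem mul_norm_sq_le_geomTensor {θ : Param M} {γ : ℝ}
    (h : (geomTensor P θ - γ • (1 : Matrix (Fin M) (Fin M) ℝ)).PosSemidef) (v : Param M) :
    γ * ‖v‖ ^ 2 ≤ ‖fderiv ℝ (ansatz P) θ v‖ ^ 2
        - ‖inner ℂ (ansatz P θ) (fderiv ℝ (ansatz P) θ v)‖ ^ 2 := by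
  rw [← geomTensor_quadratic]
  have h0 := h.dotProduct_mulVec_nonneg (v : Fin M → ℝ)
  rw [Matrix.sub_mulVec, dotProduct_sub, Matrix.smul_mulVec, Matrix.one_mulVec] at h0
  have h1 : star (v : Fin M → ℝ) ⬝ᵥ (γ • (v : Fin M → ℝ)) = γ * ‖v‖ ^ 2 := by
    rw [EuclideanSpace.norm_sq_eq, dotProduct_smul, smul_eq_mul]
    simp [dotProduct, pow_two]
  have h2 : star (v : Fin M → ℝ) ⬝ᵥ (geomTensor P θ).mulVec (v : Fin M → ℝ)
      = ∑ i, ∑ j, v i * v j * geomTensor P θ i j := by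
    simp only [dotProduct, Matrix.mulVec, Finset.mul_sum, star_trivial]
    exact Finset.sum_congr rfl fun i _ => Finset.sum_congr rfl fun j _ => by ring
  linarith

theorem le_hessian_energy (hA : IsSelfAdjoint A) (hnd : NondegenerateGround A) {θ : Param M}
    (hψ : IsGroundState A (ansatz P θ)) {γ Δ : ℝ} (hγ : 0 < γ) (hΔ : 0 < Δ) (hgap : Δ ≤ gap A)
    (h : (geomTensor P θ - γ • (1 : Matrix (Fin M) (Fin M) ℝ)).PosSemidef) (v : Param M) :
    2 * (γ * Δ) * ‖v‖ ^ 2 ≤ inner ℝ (fderiv ℝ (gradient (energy P A)) θ v) v := by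
  rw [hessian_energy_eq P hA hψ]
  have h1 := gap_mul_le hA hnd hψ (fderiv ℝ (ansatz P) θ v)
  have h2 := mul_norm_sq_le_geomTensor P h v
  have h3 : Δ * (γ * ‖v‖ ^ 2) ≤ gap A * (‖fderiv ℝ (ansatz P) θ v‖ ^ 2
      - ‖inner ℂ (ansatz P θ) (fderiv ℝ (ansatz P) θ v)‖ ^ 2) :=
    mul_le_mul hgap h2 (by positivity) (hΔ.le.trans hgap)
  linarith

end hessian

/-! ### Gradient descent near a nondegenerate minimum -/

section descent
variable {V : Type*} [NormedAddCommGroup V] [InnerProductSpace ℝ V]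

theorem opNorm_le_of_abs_inner_le {T : V →L[ℝ] V} (hT : ∀ v w, inner ℝ (T v) w = inner ℝ v (T w))
    {c : ℝ} (hc : 0 ≤ c) (h : ∀ v, |inner ℝ (T v) v| ≤ c * ‖v‖ ^ 2) : ‖T‖ ≤ c := by
  have hsym : (T : V →ₗ[ℝ] V).IsSymmetric := hT
  rw [T.norm_eq_iSup_rayleighQuotient hsym]
  refine ciSup_le fun v => ?_
  rw [ContinuousLinearMap.rayleighQuotient, ContinuousLinearMap.reApplyInnerSelf_apply, abs_div,
    abs_of_nonneg (sq_nonneg ‖v‖)]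
  exact div_le_of_le_mul₀ (sq_nonneg _) hc (h v)

/-- On a convex set where `m ≤ Dg ≤ L`, a gradient step with learning rate `1 / L` is a
contraction: its derivative `1 - Dg / L` lies between `0` and `1 - m / L`. -/
theorem norm_gradientStep_sub_le {g : V → V} (hg : Differentiable ℝ g)
    (hsym : ∀ x v w, inner ℝ (fderiv ℝ g x v) w = inner ℝ v (fderiv ℝ g x w)) {S : Set V}
    (hS : Convex ℝ S) {m L : ℝ} (hL : 0 < L) (hmL : m ≤ L)
    (hm : ∀ x ∈ S, ∀ v, m * ‖v‖ ^ 2 ≤ inner ℝ (fderiv ℝ g x v) v)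
    (hLip : ∀ x, ‖fderiv ℝ g x‖ ≤ L) {x y : V} (hx : x ∈ S) (hy : y ∈ S) :
    ‖(x - (1 / L) • g x) - (y - (1 / L) • g y)‖ ≤ (1 - m / L) * ‖x - y‖ := by
  refine Convex.norm_image_sub_le_of_norm_hasFDerivWithin_le (𝕜 := ℝ)
    (f := fun x => x - (1 / L) • g x)
    (f' := fun x => ContinuousLinearMap.id ℝ V - (1 / L) • fderiv ℝ g x)
    (fun z _ => ((hasFDerivAt_id z).sub
      ((hg z).hasFDerivAt.const_smul (1 / L))).hasFDerivWithinAt)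
    (fun z hz => ?_) hS hy hx
  refine opNorm_le_of_abs_inner_le (fun v w => ?_) (by rw [sub_nonneg, div_le_one hL]; exact hmL)
    fun v => ?_
  · simp only [sub_apply, smul_apply, ContinuousLinearMap.id_apply, inner_sub_left,
      inner_sub_right, real_inner_smul_left, real_inner_smul_right, hsym]
  · have h1 := hm z hz v
    have h2 : inner ℝ (fderiv ℝ g z v) v ≤ L * ‖v‖ ^ 2 := by
      calc inner ℝ (fderiv ℝ g z v) v ≤ ‖fderiv ℝ g z v‖ * ‖v‖ := real_inner_le_norm _ _
        _ ≤ (L * ‖v‖) * ‖v‖ := mul_le_mul_of_nonneg_right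
            (((fderiv ℝ g z).le_opNorm v).trans
              (mul_le_mul_of_nonneg_right (hLip z) (norm_nonneg _))) (norm_nonneg _)
        _ = L * ‖v‖ ^ 2 := by ring
    simp only [sub_apply, smul_apply, ContinuousLinearMap.id_apply, inner_sub_left,
      real_inner_smul_left, real_inner_self_eq_norm_sq]
    have h3 : (1 / L) * (m * ‖v‖ ^ 2) ≤ (1 / L) * inner ℝ (fderiv ℝ g z v) v :=
      mul_le_mul_of_nonneg_left h1 (by positivity)
    have h4 : (1 / L) * inner ℝ (fderiv ℝ g z v) v ≤ (1 / L) * (L * ‖v‖ ^ 2) :=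
      mul_le_mul_of_nonneg_left h2 (by positivity)
    have h5 : (1 / L) * (L * ‖v‖ ^ 2) = ‖v‖ ^ 2 := by field_simp
    have h6 : (1 / L) * (m * ‖v‖ ^ 2) = m / L * ‖v‖ ^ 2 := by ring
    rw [abs_of_nonneg (by linarith)]
    linarith

theorem mul_norm_sq_le_inner_of_contracting {g : V → V} {m L : ℝ} (hL : 0 < L) {x y : V}
    (h : ‖(x - (1 / L) • g x) - (y - (1 / L) • g y)‖ ≤ (1 - m / L) * ‖x - y‖) :
    m * ‖x - y‖ ^ 2 ≤ inner ℝ (g x - g y) (x - y) := by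
  have h1 : inner ℝ ((x - (1 / L) • g x) - (y - (1 / L) • g y)) (x - y)
      = ‖x - y‖ ^ 2 - (1 / L) * inner ℝ (g x - g y) (x - y) := by
    rw [← real_inner_self_eq_norm_sq, ← real_inner_smul_left, ← inner_sub_left]
    congr 1
    module
  have h2 := (real_inner_le_norm ((x - (1 / L) • g x) - (y - (1 / L) • g y)) (x - y)).trans
    (mul_le_mul_of_nonneg_right h (norm_nonneg _))
  rw [h1] at h2
  have h3 : (1 / L) * (m * ‖x - y‖ ^ 2) ≤ (1 / L) * inner ℝ (g x - g y) (x - y) := by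
    calc (1 / L) * (m * ‖x - y‖ ^ 2)
        = ‖x - y‖ ^ 2 - (1 - m / L) * ‖x - y‖ * ‖x - y‖ := by ring
      _ ≤ _ := by linarith
  exact le_of_mul_le_mul_left h3 (by positivity)

variable [CompleteSpace V] {E : V → ℝ}

theorem hasDerivAt_comp_line (hE : Differentiable ℝ E) (x d : V) (t : ℝ) :
    HasDerivAt (fun t : ℝ => E (x + t • d)) (inner ℝ (gradient E (x + t • d)) d) t := by
  rw [inner_gradient_left]
  have h : HasDerivAt (fun t : ℝ => x + t • d) d t := by
    simpa using ((hasDerivAt_id t).smul_const d).const_add x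
  exact (hE (x + t • d)).hasFDerivAt.comp_hasDerivAt t h

/-- The descent lemma for an `L`-smooth function. -/
theorem gradientStep_le (hE : Differentiable ℝ E) {L : ℝ} (hL : 0 < L)
    (hLip : ∀ x y, ‖gradient E x - gradient E y‖ ≤ L * ‖x - y‖) (x : V) :
    E (x - (1 / L) • gradient E x) ≤ E x - ‖gradient E x‖ ^ 2 / (2 * L) := by
  set d := gradient E x with hd
  let φ : ℝ → ℝ := fun t => E (x + t • d) - (t * ‖d‖ ^ 2 + L * ‖d‖ ^ 2 / 2 * t ^ 2)
  have hφ : ∀ t, HasDerivAt φ (inner ℝ (gradient E (x + t • d)) d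
      - (‖d‖ ^ 2 + L * ‖d‖ ^ 2 * t)) t := by
    intro t
    refine ((hasDerivAt_comp_line hE x d t).sub
      (((hasDerivAt_id t).mul_const (‖d‖ ^ 2)).add
        (((hasDerivAt_id t).pow 2).const_mul (L * ‖d‖ ^ 2 / 2)))).congr_deriv ?_
    simp only [id, Nat.cast_ofNat]
    ring
  -- along the ray `t ≤ 0` the function lies below its quadratic majorant
  have hmono : MonotoneOn φ (Set.Icc (-(1 / L)) 0) := by
    refine monotoneOn_of_deriv_nonneg (convex_Icc _ _)
      (fun t _ => (hφ t).continuousAt.continuousWithinAt)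
      (fun t _ => (hφ t).differentiableAt.differentiableWithinAt) fun t ht => ?_
    rw [interior_Icc] at ht
    rw [(hφ t).deriv]
    have h1 : ‖gradient E (x + t • d) - d‖ ≤ L * (-t * ‖d‖) := by
      have := hLip (x + t • d) x
      rwa [add_sub_cancel_left, norm_smul, Real.norm_eq_abs, abs_of_neg ht.2] at this
    have h2 := neg_le_of_abs_le (abs_real_inner_le_norm (gradient E (x + t • d) - d) d)
    rw [inner_sub_left, real_inner_self_eq_norm_sq] at h2
    have h3 := mul_le_mul_of_nonneg_right h1 (norm_nonneg d)
    linarith [show L * (-t * ‖d‖) * ‖d‖ = -(L * ‖d‖ ^ 2 * t) by ring]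
  have hneg : -(1 / L) ≤ 0 := by
    rw [neg_nonpos]
    positivity
  have h := hmono (Set.left_mem_Icc.2 hneg) (Set.right_mem_Icc.2 hneg) hneg
  simp only [φ, zero_smul, add_zero, neg_smul, ← sub_eq_add_neg] at h
  have e : -(1 / L) * ‖d‖ ^ 2 + L * ‖d‖ ^ 2 / 2 * (-(1 / L)) ^ 2 = -(‖d‖ ^ 2 / (2 * L)) := by
    field_simp
    ring
  linarith

/-- The Polyak–Łojasiewicz inequality. -/
theorem sub_le_norm_gradient_sq (hE : Differentiable ℝ E) {S : Set V} (hS : Convex ℝ S) {m : ℝ}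
    (hm : 0 < m) (hmono : ∀ x ∈ S, ∀ y ∈ S, m * ‖x - y‖ ^ 2
      ≤ inner ℝ (gradient E x - gradient E y) (x - y)) {x y : V} (hx : x ∈ S) (hy : y ∈ S) :
    E x - E y ≤ ‖gradient E x‖ ^ 2 / (2 * m) := by
  set d := x - y with hd
  let φ : ℝ → ℝ := fun t => E (y + t • d) - (inner ℝ (gradient E x) d * t
    - m * ‖d‖ ^ 2 * (t - t ^ 2 / 2))
  have hφ : ∀ t, HasDerivAt φ (inner ℝ (gradient E (y + t • d)) d
      - (inner ℝ (gradient E x) d - m * ‖d‖ ^ 2 * (1 - t))) t := by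
    intro t
    refine ((hasDerivAt_comp_line hE y d t).sub
      (((hasDerivAt_id t).const_mul (inner ℝ (gradient E x) d)).sub
        (((hasDerivAt_id t).sub (((hasDerivAt_id t).pow 2).div_const 2)).const_mul
          (m * ‖d‖ ^ 2)))).congr_deriv ?_
    simp only [id, Nat.cast_ofNat]
    ring
  have hanti : AntitoneOn φ (Set.Icc 0 1) := by
    refine antitoneOn_of_deriv_nonpos (convex_Icc _ _)
      (fun t _ => (hφ t).continuousAt.continuousWithinAt)
      (fun t _ => (hφ t).differentiableAt.differentiableWithinAt) fun t ht => ?_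
    rw [interior_Icc] at ht
    rw [(hφ t).deriv]
    have hz : y + t • d ∈ S := by
      have := hS hy hx (a := 1 - t) (b := t) (by linarith [ht.2]) ht.1.le (by ring)
      convert this using 1
      rw [hd]
      module
    have h1 := hmono x hx _ hz
    have e : x - (y + t • d) = (1 - t) • d := by rw [hd]; module
    rw [e, norm_smul, real_inner_smul_right, inner_sub_left,
      Real.norm_of_nonneg (by linarith [ht.2])] at h1
    have h2 : (1 - t) * (m * ‖d‖ ^ 2 * (1 - t))
        ≤ (1 - t) * (inner ℝ (gradient E x) d - inner ℝ (gradient E (y + t • d)) d) :=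
      le_trans (le_of_eq (by ring)) h1
    have h3 := le_of_mul_le_mul_left h2 (by linarith [ht.2])
    linarith
  have h := hanti (Set.left_mem_Icc.2 zero_le_one) (Set.right_mem_Icc.2 zero_le_one) zero_le_one
  have e : y + (1 : ℝ) • d = x := by rw [hd]; module
  simp only [φ, e, zero_smul, add_zero] at h
  have h4 := real_inner_le_norm (gradient E x) d
  -- complete the square
  have h5 : ‖gradient E x‖ * ‖d‖ - m * ‖d‖ ^ 2 / 2 ≤ ‖gradient E x‖ ^ 2 / (2 * m) := by
    rw [le_div_iff₀ (by positivity)]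
    nlinarith [sq_nonneg (‖gradient E x‖ - m * ‖d‖)]
  linarith

theorem gradientStep_sub_le (hE : Differentiable ℝ E) {L m : ℝ} (hL : 0 < L) (hm : 0 < m)
    (hLip : ∀ x y, ‖gradient E x - gradient E y‖ ≤ L * ‖x - y‖) {S : Set V} (hS : Convex ℝ S)
    (hmono : ∀ x ∈ S, ∀ y ∈ S, m * ‖x - y‖ ^ 2
      ≤ inner ℝ (gradient E x - gradient E y) (x - y)) {x y : V} (hx : x ∈ S) (hy : y ∈ S) :
    E (x - (1 / L) • gradient E x) - E y ≤ (1 - m / L) * (E x - E y) := by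
  have h1 := gradientStep_le hE hL hLip x
  have h2 := mul_le_mul_of_nonneg_left (sub_le_norm_gradient_sq hE hS hm hmono hx hy)
    (by positivity : 0 ≤ m / L)
  have e : m / L * (‖gradient E x‖ ^ 2 / (2 * m)) = ‖gradient E x‖ ^ 2 / (2 * L) := by
    field_simp
  linarith

end descent

/-- A continuous curve whose local speed is at most `C` is `C`-Lipschitz, without any
differentiability. -/
theorem norm_sub_le_of_eventually_norm_sub_le {F : Type*} [NormedAddCommGroup F]
    [NormedSpace ℝ F] {f : ℝ → F} {a b C : ℝ} (hab : a ≤ b) (hf : ContinuousOn f (Set.Icc a b))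
    (h : ∀ x ∈ Set.Ico a b, ∀ C' > C, ∀ᶠ z in nhdsWithin x (Set.Ioi x),
      ‖f z - f x‖ ≤ C' * (z - x)) :
    ‖f b - f a‖ ≤ C * (b - a) := by
  have key : ∀ C' > C, ‖f b - f a‖ ≤ C' * (b - a) := by
    intro C' hC'
    refine image_norm_le_of_liminf_right_slope_norm_lt_deriv_boundary
      (f := fun x => f x - f a) (f' := fun _ => C) (B := fun x => C' * (x - a))
      (B' := fun _ => C') (hf.sub continuousOn_const) ?_ (by simp) (by fun_prop) ?_
      (fun _ _ _ => hC') (Set.right_mem_Icc.2 hab)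
    · intro x hx r hr
      refine Filter.Eventually.frequently ?_
      filter_upwards [h x hx ((C + r) / 2) (by linarith), self_mem_nhdsWithin] with z hz hxz
      have hpos : 0 < z - x := sub_pos.2 hxz
      rw [slope_def_field, div_lt_iff₀ hpos]
      have h1 : ‖f z - f a‖ - ‖f x - f a‖ ≤ ‖f z - f x‖ := by
        simpa using norm_sub_norm_le (f z - f a) (f x - f a)
      have h2 : (C + r) / 2 * (z - x) < r * (z - x) := mul_lt_mul_of_pos_right (by linarith) hpos
      simp only [Function.comp_apply]
      linarith
    · intro x _
      simpa using (((hasDerivAt_id x).sub_const a).const_mul C').hasDerivWithinAt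
  refine le_of_forall_pos_le_add fun ε hε => ?_
  refine (key (C + ε / (b - a + 1)) (by
    have : 0 < ε / (b - a + 1) := div_pos hε (by linarith)
    linarith)).trans ?_
  rw [add_mul]
  have : ε / (b - a + 1) * (b - a) ≤ ε := by
    rw [div_mul_eq_mul_div, div_le_iff₀ (by linarith)]
    nlinarith
  linarith

/-! ### The energy near the path of minimizers -/

section nearPath
variable {n M : ℕ} {P : Fin M → Fin n → Pauli} {Hi Hf : QOp n} {θs : ℝ → Param M} {γ L : ℝ}

theorem energySmooth : EnergySmooth P Hi Hf (4 * pathNorm Hi Hf * M) := fun lam hlam θ θ' =>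
  (hasShiftRule_energy P (ham Hi Hf lam)).norm_gradient_sub_le
    (fun θ => (abs_energy_le P _ θ).trans (norm_ham_le_pathNorm Hi Hf hlam)) θ θ'

theorem norm_fderiv_gradient_le (hL0 : 0 ≤ L) (hL : EnergySmooth P Hi Hf L) {lam : ℝ}
    (hlam : lam ∈ Set.Icc (0 : ℝ) 1) (θ : Param M) :
    ‖fderiv ℝ (gradient (energy P (ham Hi Hf lam))) θ‖ ≤ L :=
  norm_fderiv_le_of_lip' ℝ hL0 (Filter.Eventually.of_forall fun θ' => hL lam hlam θ' θ)

/-- The Hessian at the minimizers is at least `2 γ Δ_min`. -/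
def HessianLowerBound (P : Fin M → Fin n → Pauli) (Hi Hf : QOp n) (γ : ℝ)
    (θs : ℝ → Param M) : Prop :=
  ∀ lam ∈ Set.Icc (0 : ℝ) 1, ∀ v : Param M, 2 * (γ * minGap Hi Hf) * ‖v‖ ^ 2
    ≤ inner ℝ (fderiv ℝ (gradient (energy P (ham Hi Hf lam))) (θs lam) v) v

theorem two_mul_le_of_hessianLowerBound (hM : 1 ≤ M) (hL : EnergySmooth P Hi Hf L)
    (hess : HessianLowerBound P Hi Hf γ θs) : 2 * (γ * minGap Hi Hf) ≤ L := by
  have h0 : (0 : ℝ) ∈ Set.Icc (0 : ℝ) 1 := ⟨le_rfl, zero_le_one⟩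
  set e : Param M := EuclideanSpace.single ⟨0, hM⟩ 1 with he
  have hne : ‖e‖ = 1 := by rw [he]; simp
  have hL0 : 0 ≤ L := by
    have := (norm_nonneg _).trans (hL 0 h0 e 0)
    rwa [sub_zero, hne, mul_one] at this
  have h1 := hess 0 h0 e
  have h2 := real_inner_le_norm (fderiv ℝ (gradient (energy P (ham Hi Hf 0))) (θs 0) e) e
  have h3 := (fderiv ℝ (gradient (energy P (ham Hi Hf 0))) (θs 0)).le_of_opNorm_le
    (norm_fderiv_gradient_le hL0 hL h0 (θs 0)) e
  rw [hne] at h1 h2 h3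
  linarith

/-- The third derivatives of the energy are bounded by `8 ‖H‖`, which makes the Hessian
`hessLip / 3`-Lipschitz: the constant `24` leaves a factor `3` to spare. -/
theorem le_hessian_of_norm_sub_le (hess : HessianLowerBound P Hi Hf γ θs) {lam : ℝ}
    (hlam : lam ∈ Set.Icc (0 : ℝ) 1) {ρ : ℝ} {θ : Param M}
    (hθ : θ ∈ Metric.closedBall (θs lam) ρ) (v : Param M) :
    (2 * (γ * minGap Hi Hf) - hessLip M Hi Hf / 3 * ρ) * ‖v‖ ^ 2
      ≤ inner ℝ (fderiv ℝ (gradient (energy P (ham Hi Hf lam))) θ v) v := by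
  have hH : 0 ≤ pathNorm Hi Hf := (norm_nonneg _).trans (norm_ham_le_pathNorm Hi Hf hlam)
  have h1 := (abs_le.1 ((hasShiftRule_energy P (ham Hi Hf lam)).abs_hessian_sub_le
    (fun θ => (abs_energy_le P _ θ).trans (norm_ham_le_pathNorm Hi Hf hlam)) θ (θs lam) v)).1
  have h2 := hess lam hlam v
  have h3 : 8 * pathNorm Hi Hf * (M : ℝ) ^ (3 / 2 : ℝ) * ‖θ - θs lam‖ * ‖v‖ ^ 2
      ≤ 8 * pathNorm Hi Hf * (M : ℝ) ^ (3 / 2 : ℝ) * ρ * ‖v‖ ^ 2 := by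
    have := mem_closedBall_iff_norm.1 hθ
    gcongr
  rw [hessLip]
  linarith

theorem norm_gdStep_sub_le (hLpos : 0 < L) (hL : EnergySmooth P Hi Hf L)
    (h2L : 2 * (γ * minGap Hi Hf) ≤ L) (hess : HessianLowerBound P Hi Hf γ θs) {lam : ℝ}
    (hlam : lam ∈ Set.Icc (0 : ℝ) 1) {ρ m : ℝ} (hℓ : 0 ≤ hessLip M Hi Hf * ρ)
    (hm : m = 2 * (γ * minGap Hi Hf) - hessLip M Hi Hf / 3 * ρ) {θ θ' : Param M}
    (hθ : θ ∈ Metric.closedBall (θs lam) ρ) (hθ' : θ' ∈ Metric.closedBall (θs lam) ρ) :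
    ‖gdStep P (ham Hi Hf lam) (1 / L) θ - gdStep P (ham Hi Hf lam) (1 / L) θ'‖
      ≤ (1 - m / L) * ‖θ - θ'‖ :=
  norm_gradientStep_sub_le (hasShiftRule_energy P _).differentiable_gradient
    (hasShiftRule_energy P _).fderiv_gradient_symm (convex_closedBall (θs lam) ρ) hLpos
    (by linarith) (fun _ hx v => hm ▸ le_hessian_of_norm_sub_le hess hlam hx v)
    (norm_fderiv_gradient_le hLpos.le hL hlam) hθ hθ'

/-- The minimizers move with speed at most `√M ‖H_f - H_i‖ / (γ Δ_min)`. On a small ball the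
gradient is strongly monotone with a constant close to `2 γ Δ_min`, so two nearby minimizers are
separated by at most the change of the gradient over that constant. -/
theorem norm_minimizer_sub_le (hLpos : 0 < L) (hL : EnergySmooth P Hi Hf L)
    (h2L : 2 * (γ * minGap Hi Hf) ≤ L) (hess : HessianLowerBound P Hi Hf γ θs)
    (hθs : ContinuousOn θs (Set.Icc 0 1))
    (hgrad : ∀ lam ∈ Set.Icc (0 : ℝ) 1, gradient (energy P (ham Hi Hf lam)) (θs lam) = 0)
    (hμ : 0 < γ * minGap Hi Hf) (hℓ : 0 < hessLip M Hi Hf) {a b : ℝ} (ha : 0 ≤ a) (hab : a ≤ b)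
    (hb : b ≤ 1) :
    ‖θs b - θs a‖ ≤ Real.sqrt M * ‖Hf - Hi‖ / (γ * minGap Hi Hf) * (b - a) := by
  have hsub : Set.Icc a b ⊆ Set.Icc 0 1 := Set.Icc_subset_Icc ha hb
  refine norm_sub_le_of_eventually_norm_sub_le hab (hθs.mono hsub) fun x hx C hC => ?_
  set μ := γ * minGap Hi Hf with hμd
  set ℓ := hessLip M Hi Hf
  set V := Real.sqrt M * ‖Hf - Hi‖ / μ with hV
  have hV0 : 0 ≤ V := by positivity
  have hVμ : Real.sqrt M * ‖Hf - Hi‖ = V * μ := by rw [hV]; field_simp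
  have hC0 : 0 < C := hV0.trans_lt hC
  have hx01 : x ∈ Set.Icc (0 : ℝ) 1 := hsub ⟨hx.1, hx.2.le⟩
  -- the radius on which the monotonicity constant `m` still satisfies `2 V μ ≤ m C`
  set ρ := 3 * ((C - V) * μ / (C * ℓ)) with hρ
  have hρ0 : 0 < ρ := by
    have := sub_pos.2 hC
    positivity
  set m := 2 * μ - ℓ / 3 * ρ with hm
  have hmC : m * C = (C + V) * μ := by rw [hm, hρ]; field_simp; ring
  have hm0 : 0 < m := by
    have h : 0 < m * C := hmC ▸ mul_pos (by linarith) hμ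
    exact pos_of_mul_pos_left h hC0.le
  have hcont : Filter.Tendsto θs (nhdsWithin x (Set.Ioi x)) (nhds (θs x)) := by
    refine ((hθs.mono hsub) x ⟨hx.1, hx.2.le⟩).mono_left ?_
    rw [← nhdsWithin_Ioo_eq_nhdsGT hx.2]
    exact nhdsWithin_mono _ fun z hz => ⟨hx.1.trans hz.1.le, hz.2.le⟩
  have hball := hcont (Metric.closedBall_mem_nhds (θs x) hρ0)
  filter_upwards [hball, Ioo_mem_nhdsGT hx.2] with z hz hxz
  have hz01 : z ∈ Set.Icc (0 : ℝ) 1 := hsub ⟨hx.1.trans hxz.1.le, hxz.2.le⟩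
  have h1 := mul_norm_sq_le_inner_of_contracting hLpos
    (norm_gdStep_sub_le (θ := θs z) (θ' := θs x) hLpos hL h2L hess hx01
      (mul_pos hℓ hρ0).le hm hz (Metric.mem_closedBall_self hρ0.le))
  have h2 := norm_gradient_ham_sub_le P Hi Hf x z (θs z)
  rw [hgrad z hz01, sub_zero, abs_of_neg (by linarith [hxz.1])] at h2
  rw [hgrad x hx01, sub_zero] at h1
  have h3 := h1.trans ((real_inner_le_norm _ _).trans
    (mul_le_mul_of_nonneg_right h2 (norm_nonneg _)))
  rcases (norm_nonneg (θs z - θs x)).eq_or_lt with h0 | hpos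
  · rw [← h0]
    exact mul_nonneg hC0.le (by linarith [hxz.1])
  · have h4 : m * ‖θs z - θs x‖ ≤ 2 * (V * μ) * (z - x) := by
      refine le_of_mul_le_mul_right ?_ hpos
      calc m * ‖θs z - θs x‖ * ‖θs z - θs x‖ = m * ‖θs z - θs x‖ ^ 2 := by ring
        _ ≤ _ := h3
        _ = _ := by rw [← hVμ]; ring
    refine le_of_mul_le_mul_left ?_ hm0
    calc m * ‖θs z - θs x‖ ≤ 2 * (V * μ) * (z - x) := h4
      _ ≤ (C + V) * μ * (z - x) := by
          refine mul_le_mul_of_nonneg_right ?_ (by linarith [hxz.1])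
          nlinarith
      _ = m * (C * (z - x)) := by rw [← hmC]; ring

end nearPath

/-! ### Runs of warm-started descent -/

section tracking
variable {n M : ℕ} {P : Fin M → Fin n → Pauli} {Hi Hf : QOp n} {θs : ℝ → Param M} {γ L c : ℝ}

theorem norm_descend_sub_le {η lam r : ℝ} {θ' : Param M} (hc0 : 0 ≤ c) (hc1 : c ≤ 1)
    (hstep : ∀ θ, ‖θ - θ'‖ ≤ r → ‖gdStep P (ham Hi Hf lam) η θ - θ'‖ ≤ c * ‖θ - θ'‖)
    {θ : Param M} (hθ : ‖θ - θ'‖ ≤ r) (k : ℕ) :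
    ‖descend P Hi Hf η lam k θ - θ'‖ ≤ c ^ k * ‖θ - θ'‖ := by
  induction k with
  | zero => simp [descend]
  | succ k ih =>
    have hk : ‖descend P Hi Hf η lam k θ - θ'‖ ≤ r :=
      ih.trans ((mul_le_of_le_one_left (norm_nonneg _) (pow_le_one₀ hc0 hc1)).trans hθ)
    have h : descend P Hi Hf η lam (k + 1) θ
        = gdStep P (ham Hi Hf lam) η (descend P Hi Hf η lam k θ) := by
      rw [descend, Function.iterate_succ_apply']
      rfl
    rw [h, pow_succ']
    calc _ ≤ c * ‖descend P Hi Hf η lam k θ - θ'‖ := hstep _ hk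
      _ ≤ c * (c ^ k * ‖θ - θ'‖) := mul_le_mul_of_nonneg_left ih hc0
      _ = _ := by ring

/-- If a gradient step contracts distances to the minimizer by `c` within the radius `r`, and the
minimizer moves by at most `s ≤ r / 2` per slice, the distance after each slice stays below `r / 2`
provided that the `K` steps of a slice bring the distance `r / 2 + s` back below `r / 2`. -/
theorem norm_warmStart_sub_le {η r : ℝ} (hc0 : 0 ≤ c) (hc1 : c ≤ 1) (hr : 0 ≤ r)
    (hstep : ∀ lam ∈ Set.Icc (0 : ℝ) 1, ∀ θ, ‖θ - θs lam‖ ≤ r →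
      ‖gdStep P (ham Hi Hf lam) η θ - θs lam‖ ≤ c * ‖θ - θs lam‖)
    {T K : ℕ} (hT : 1 ≤ T) {s : ℝ}
    (hs : ∀ t < T, ‖θs ((t : ℝ) / T) - θs (((t + 1 : ℕ) : ℝ) / T)‖ ≤ s)
    (hsr : s ≤ r / 2) (hK : c ^ K * (r / 2 + s) ≤ r / 2) :
    ∀ t ≤ T, ‖warmStart P Hi Hf η T K (θs 0) t - θs ((t : ℝ) / T)‖ ≤ r / 2 := by
  have hTpos : (0 : ℝ) < T := by exact_mod_cast hT
  intro t
  induction t with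
  | zero =>
    intro _
    simp only [warmStart, Nat.cast_zero, zero_div, sub_self, norm_zero]
    linarith
  | succ t ih =>
    intro ht
    have h1 : ‖warmStart P Hi Hf η T K (θs 0) t - θs (((t + 1 : ℕ) : ℝ) / T)‖ ≤ r / 2 + s :=
      (norm_sub_le_norm_sub_add_norm_sub _ (θs ((t : ℝ) / T)) _).trans
        (add_le_add (ih (Nat.le_of_succ_le ht)) (hs t ht))
    have hmem : ((t + 1 : ℕ) : ℝ) / T ∈ Set.Icc (0 : ℝ) 1 :=
      ⟨by positivity, by rw [div_le_one hTpos]; exact_mod_cast ht⟩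
    refine (norm_descend_sub_le hc0 hc1 (hstep _ hmem) (h1.trans (by linarith)) K).trans ?_
    exact (mul_le_mul_of_nonneg_left h1 (pow_nonneg hc0 K)).trans hK

/-- A run that stays within `r / 2` of the minimizers after each slice tracks the ground state if
gradient steps within the radius `r` contract the distance and, at the end of the path, the excess
energy. -/
theorem tracksGroundState_of_norm_warmStart_sub_le (hc0 : 0 ≤ c)
    (hc : c ≤ Real.sqrt (1 - γ * minGap Hi Hf / L)) (hq0 : 0 ≤ γ * minGap Hi Hf / L)
    (hq1 : γ * minGap Hi Hf / L ≤ 1) (hr : 0 ≤ plRadius M Hi Hf γ)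
    (hstep : ∀ lam ∈ Set.Icc (0 : ℝ) 1, ∀ θ, ‖θ - θs lam‖ ≤ plRadius M Hi Hf γ →
      ‖gdStep P (ham Hi Hf lam) (1 / L) θ - θs lam‖ ≤ c * ‖θ - θs lam‖)
    (henergy : ∀ θ, ‖θ - θs 1‖ ≤ plRadius M Hi Hf γ →
      energy P (ham Hi Hf 1) (gdStep P (ham Hi Hf 1) (1 / L) θ) - groundEnergy (ham Hi Hf 1)
        ≤ (1 - γ * minGap Hi Hf / L) *
          (energy P (ham Hi Hf 1) θ - groundEnergy (ham Hi Hf 1)))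
    {T K : ℕ} (hT : 1 ≤ T)
    (hs : ∀ t < T, ‖θs ((t : ℝ) / T) - θs (((t + 1 : ℕ) : ℝ) / T)‖ ≤ plRadius M Hi Hf γ / 2)
    (hi : ∀ t ≤ T, ‖warmStart P Hi Hf (1 / L) T K (θs 0) t - θs ((t : ℝ) / T)‖
      ≤ plRadius M Hi Hf γ / 2) :
    TracksGroundState P Hi Hf γ θs L T K := by
  set r := plRadius M Hi Hf γ
  set q := γ * minGap Hi Hf / L
  have hTpos : (0 : ℝ) < T := by exact_mod_cast hT
  have hc1 : c ≤ 1 := hc.trans (Real.sqrt_le_one.2 (by linarith))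
  have hfin : ‖warmStart P Hi Hf (1 / L) T K (θs 0) T - θs 1‖ ≤ r / 2 := by
    have := hi T le_rfl
    rwa [div_self hTpos.ne'] at this
  have h1mem : (1 : ℝ) ∈ Set.Icc (0 : ℝ) 1 := ⟨zero_le_one, le_rfl⟩
  have hdist : ∀ k : ℕ, ‖descend P Hi Hf (1 / L) 1 k (warmStart P Hi Hf (1 / L) T K (θs 0) T)
      - θs 1‖ ≤ c ^ k * (r / 2) := fun k =>
    (norm_descend_sub_le hc0 hc1 (hstep 1 h1mem) (hfin.trans (by linarith)) k).trans
      (mul_le_mul_of_nonneg_left hfin (pow_nonneg hc0 k))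
  refine ⟨hi, fun t ht k _ => ?_, fun k => ⟨?_, ?_⟩⟩
  · have h1 : ‖warmStart P Hi Hf (1 / L) T K (θs 0) t - θs (((t + 1 : ℕ) : ℝ) / T)‖ ≤ r :=
      (norm_sub_le_norm_sub_add_norm_sub _ (θs ((t : ℝ) / T)) _).trans
        ((add_le_add (hi t ht.le) (hs t ht)).trans (by linarith))
    have hmem : ((t + 1 : ℕ) : ℝ) / T ∈ Set.Icc (0 : ℝ) 1 :=
      ⟨by positivity, by rw [div_le_one hTpos]; exact_mod_cast ht⟩
    exact (norm_descend_sub_le hc0 hc1 (hstep _ hmem) h1 k).trans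
      (mul_le_mul (pow_le_pow_left₀ hc0 hc k) h1 (norm_nonneg _) (by positivity))
  · exact (hdist k).trans (mul_le_mul_of_nonneg_right (pow_le_pow_left₀ hc0 hc k) (by linarith))
  · induction k with
    | zero => simp [descend]
    | succ k ih =>
      have hk : ‖descend P Hi Hf (1 / L) 1 k (warmStart P Hi Hf (1 / L) T K (θs 0) T) - θs 1‖
          ≤ r := (hdist k).trans
        ((mul_le_of_le_one_left (by linarith) (pow_le_one₀ hc0 hc1)).trans (by linarith))
      have h : descend P Hi Hf (1 / L) 1 (k + 1) (warmStart P Hi Hf (1 / L) T K (θs 0) T)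
          = gdStep P (ham Hi Hf 1) (1 / L)
            (descend P Hi Hf (1 / L) 1 k (warmStart P Hi Hf (1 / L) T K (θs 0) T)) := by
        rw [descend, Function.iterate_succ_apply']
        rfl
      rw [h, pow_succ', mul_assoc]
      exact (henergy _ hk).trans (mul_le_mul_of_nonneg_left ih (by linarith))

end tracking

/-! ### Counting slices and steps -/

section counting

/-- If each step contracts by `1 - 5 q / 3`, then `⌊x K₁⌋` steps with `K₁ = 2 ln 2 / q` contract by
`1 / (1 + x)`: rounding down at most halves `x K₁ ≥ 1`, and `(5 / 3) ln 2 ≥ 1`. -/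
theorem pow_floor_mul_le {q x : ℝ} (hq0 : 0 < q) (hq : q ≤ 1 / 2) (hx : 1 / 2 < x) :
    (1 - 5 / 3 * q) ^ ⌊x * (2 * Real.log 2 / q)⌋₊ * (1 + x) ≤ 1 := by
  set y := x * (2 * Real.log 2 / q) with hy
  have hlog : 0.69 < Real.log 2 := lt_trans (by norm_num) Real.log_two_gt_d9
  have hyq : y * q = 2 * x * Real.log 2 := by rw [hy]; field_simp
  have hy1 : 1 ≤ y := by
    by_contra h
    nlinarith
  have hfl : y / 2 ≤ (⌊y⌋₊ : ℝ) := by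
    have h1 := Nat.lt_floor_add_one y
    have h2 : (1 : ℝ) ≤ (⌊y⌋₊ : ℝ) := by exact_mod_cast Nat.le_floor (by exact_mod_cast hy1)
    linarith
  have h1 : (1 - 5 / 3 * q) ^ ⌊y⌋₊ ≤ Real.exp (-x) := by
    calc (1 - 5 / 3 * q) ^ ⌊y⌋₊ ≤ Real.exp (-(5 / 3 * q)) ^ ⌊y⌋₊ :=
          pow_le_pow_left₀ (by linarith) (Real.one_sub_le_exp_neg _) _
      _ = Real.exp (⌊y⌋₊ * -(5 / 3 * q)) := by rw [Real.exp_nat_mul]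
      _ ≤ Real.exp (-x) := by
          refine Real.exp_le_exp.2 ?_
          have h2 : y / 2 * (5 / 3 * q) ≤ (⌊y⌋₊ : ℝ) * (5 / 3 * q) :=
            mul_le_mul_of_nonneg_right hfl (by positivity)
          nlinarith
  have h2 : 1 + x ≤ Real.exp x := by linarith [Real.add_one_le_exp x]
  calc _ ≤ Real.exp (-x) * Real.exp x :=
        mul_le_mul h1 h2 (by linarith) (Real.exp_pos _).le
    _ = 1 := by rw [← Real.exp_add]; simp

theorem pow_mul_le_of_steps_le {q c : ℝ} (hq0 : 0 < q) (hc0 : 0 ≤ c) (hc : c ≤ 1 - q) {K : ℕ}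
    (hK : 2 * Real.log 2 / q ≤ K) : c ^ K * 2 ≤ 1 := by
  have hK' : 2 * Real.log 2 ≤ K * q := (div_le_iff₀ hq0).1 hK
  have hlog : 0 < Real.log 2 := Real.log_pos one_lt_two
  have h1 : c ^ K ≤ Real.exp (-Real.log 2) := by
    calc c ^ K ≤ Real.exp (-q) ^ K :=
          pow_le_pow_left₀ hc0 (hc.trans (Real.one_sub_le_exp_neg _)) _
      _ = Real.exp (K * -q) := by rw [Real.exp_nat_mul]
      _ ≤ _ := Real.exp_le_exp.2 (by linarith)
  rw [Real.exp_neg, Real.exp_log two_pos] at h1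
  linarith

end counting

end AdiabaticVQE

end

/-! ### Tracking the ground state -/

theorem theorem1 (n M : ℕ) (hn : 1 ≤ n) (hM : 1 ≤ M)
    (P : Fin M → Fin n → Pauli) (Hi Hf : QOp n)
    (hHi : IsSelfAdjoint Hi) (hHf : IsSelfAdjoint Hf)
    -- spectral gap
    (hnd : ∀ lam ∈ Set.Icc (0 : ℝ) 1, NondegenerateGround (ham Hi Hf lam))
    (hgap : 0 < minGap Hi Hf)
    -- exact representability, by minimizers depending continuously on `lam`
    (θs : ℝ → Param M) (hθs : ContinuousOn θs (Set.Icc 0 1))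
    (hrep : ∀ lam ∈ Set.Icc (0 : ℝ) 1, IsGroundState (ham Hi Hf lam) (ansatz P (θs lam)))
    -- nondegenerate geometry
    (γ : ℝ) (hγ : 0 < γ)
    (hgeom : ∀ lam ∈ Set.Icc (0 : ℝ) 1,
      (geomTensor P (θs lam) - γ • (1 : Matrix (Fin M) (Fin M) ℝ)).PosSemidef) :
    EnergySmooth P Hi Hf (4 * pathNorm Hi Hf * M) ∧
    ∀ L : ℝ, EnergySmooth P Hi Hf L → L ≤ 4 * pathNorm Hi Hf * M →
      -- many steps per slice
      (∀ T K : ℕ, 1 ≤ T → slices₁ M Hi Hf γ ≤ T → steps₁ Hi Hf γ L ≤ K →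
        TracksGroundState P Hi Hf γ θs L T K) ∧
      (∃ T K : ℕ, T = max 1 ⌈slices₁ M Hi Hf γ⌉₊ ∧ (K : ℝ) ≤ steps₁ Hi Hf γ L ∧
        ((T * K : ℕ) : ℝ) ≤ 384 * Real.log 2 *
          ((M : ℝ) ^ 3 * pathNorm Hi Hf ^ 2 * ‖Hf - Hi‖ / (γ ^ 3 * minGap Hi Hf ^ 3)) ∧
        TracksGroundState P Hi Hf γ θs L T K) ∧
      -- one step per slice
      (∀ T : ℕ, 1 ≤ T → slices₂ M Hi Hf γ L ≤ T → TracksGroundState P Hi Hf γ θs L T 1) ∧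
      (∃ T : ℕ, 1 ≤ T ∧
        (T : ℝ) ≤ max 1 (384 *
          ((M : ℝ) ^ 3 * pathNorm Hi Hf ^ 2 * ‖Hf - Hi‖ / (γ ^ 3 * minGap Hi Hf ^ 3))) ∧
        TracksGroundState P Hi Hf γ θs L T 1) := by
  have hess : HessianLowerBound P Hi Hf γ θs := fun lam hlam v =>
    le_hessian_energy P (isSelfAdjoint_ham hHi hHf lam) (hnd lam hlam) (hrep lam hlam) hγ hgap
      (minGap_le_gap Hi Hf hlam) (hgeom lam hlam) v
  have hgrad : ∀ lam ∈ Set.Icc (0 : ℝ) 1, gradient (energy P (ham Hi Hf lam)) (θs lam) = 0 :=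
    fun lam hlam => gradient_energy_eq_zero P (isSelfAdjoint_ham hHi hHf lam) (hrep lam hlam)
  refine ⟨energySmooth, fun L hL hLM => ?_⟩
  have hμ : 0 < γ * minGap Hi Hf := mul_pos hγ hgap
  have h2L := two_mul_le_of_hessianLowerBound hM hL hess
  have hLpos : 0 < L := by linarith
  have hMpos : (0 : ℝ) < M := by exact_mod_cast hM
  have hHpos : 0 < pathNorm Hi Hf := by
    have h : 0 < 4 * pathNorm Hi Hf * M := hLpos.trans_le hLM
    have := pos_of_mul_pos_left h hMpos.le
    linarith
  have hℓ : 0 < hessLip M Hi Hf := by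
    rw [hessLip]
    positivity
  have hr : 0 < plRadius M Hi Hf γ := div_pos hμ hℓ
  set q := γ * minGap Hi Hf / L with hq
  have hq0 : 0 < q := div_pos hμ hLpos
  have hq2 : q ≤ 1 / 2 := by rw [hq, div_le_iff₀ hLpos]; linarith
  -- at the radius `r` the Hessian has lost `γ Δ / 3` of its lower bound `2 γ Δ`
  have hm : 5 / 3 * (γ * minGap Hi Hf)
      = 2 * (γ * minGap Hi Hf) - hessLip M Hi Hf / 3 * plRadius M Hi Hf γ := by
    rw [plRadius]
    field_simp
    ring
  have hcq : 1 - 5 / 3 * (γ * minGap Hi Hf) / L = 1 - 5 / 3 * q := by rw [hq]; ring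
  have hcontr : ∀ lam ∈ Set.Icc (0 : ℝ) 1,
      ∀ θ ∈ Metric.closedBall (θs lam) (plRadius M Hi Hf γ),
      ∀ θ' ∈ Metric.closedBall (θs lam) (plRadius M Hi Hf γ),
      ‖gdStep P (ham Hi Hf lam) (1 / L) θ - gdStep P (ham Hi Hf lam) (1 / L) θ'‖
        ≤ (1 - 5 / 3 * (γ * minGap Hi Hf) / L) * ‖θ - θ'‖ := fun lam hlam θ hθ θ' hθ' =>
    norm_gdStep_sub_le hLpos hL h2L hess hlam (mul_pos hℓ hr).le hm hθ hθ'
  have hstep : ∀ lam ∈ Set.Icc (0 : ℝ) 1, ∀ θ, ‖θ - θs lam‖ ≤ plRadius M Hi Hf γ →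
      ‖gdStep P (ham Hi Hf lam) (1 / L) θ - θs lam‖ ≤ (1 - 5 / 3 * q) * ‖θ - θs lam‖ := by
    intro lam hlam θ hθ
    have h := hcontr lam hlam θ (mem_closedBall_iff_norm.2 hθ) (θs lam)
      (Metric.mem_closedBall_self hr.le)
    have hfix : gdStep P (ham Hi Hf lam) (1 / L) (θs lam) = θs lam := by
      rw [gdStep, hgrad lam hlam, smul_zero, sub_zero]
    rwa [hfix, hcq] at h
  have h1mem : (1 : ℝ) ∈ Set.Icc (0 : ℝ) 1 := ⟨zero_le_one, le_rfl⟩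
  have henergy : ∀ θ, ‖θ - θs 1‖ ≤ plRadius M Hi Hf γ →
      energy P (ham Hi Hf 1) (gdStep P (ham Hi Hf 1) (1 / L) θ) - groundEnergy (ham Hi Hf 1)
        ≤ (1 - q) * (energy P (ham Hi Hf 1) θ - groundEnergy (ham Hi Hf 1)) := by
    intro θ hθ
    rw [← energy_eq_groundEnergy P (hrep 1 h1mem)]
    refine gradientStep_sub_le (hasShiftRule_energy P _).differentiable hLpos hμ (hL 1 h1mem)
      (convex_closedBall (θs 1) (plRadius M Hi Hf γ)) (fun x hx y hy => ?_)
      (mem_closedBall_iff_norm.2 hθ) (Metric.mem_closedBall_self hr.le)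
    have h := mul_norm_sq_le_inner_of_contracting hLpos (hcontr 1 h1mem x hx y hy)
    have h' : 0 ≤ γ * minGap Hi Hf * ‖x - y‖ ^ 2 := by positivity
    linarith
  have hc0 : 0 ≤ 1 - 5 / 3 * q := by linarith
  have hcsqrt : 1 - 5 / 3 * q ≤ Real.sqrt (1 - q) := Real.le_sqrt_of_sq_le (by nlinarith)
  -- the distance of consecutive minimizers for `T` slices
  set v := Real.sqrt M * ‖Hf - Hi‖ / (γ * minGap Hi Hf) with hv
  have hshift : ∀ T : ℕ, 1 ≤ T → ∀ t < T,
      ‖θs ((t : ℝ) / T) - θs (((t + 1 : ℕ) : ℝ) / T)‖ ≤ v / T := by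
    intro T hT t ht
    have hTpos : (0 : ℝ) < T := by exact_mod_cast hT
    rw [norm_sub_rev]
    refine (norm_minimizer_sub_le hLpos hL h2L hess hθs hgrad hμ hℓ (by positivity)
      (by gcongr; exact_mod_cast Nat.le_succ t)
      (by rw [div_le_one hTpos]; exact_mod_cast ht)).trans_eq ?_
    push_cast
    ring
  have htrack₀ : ∀ T K : ℕ, 1 ≤ T → v / T ≤ plRadius M Hi Hf γ / 2 →
      (∀ t ≤ T, ‖warmStart P Hi Hf (1 / L) T K (θs 0) t - θs ((t : ℝ) / T)‖
        ≤ plRadius M Hi Hf γ / 2) → TracksGroundState P Hi Hf γ θs L T K := fun T K hT hs hi =>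
    tracksGroundState_of_norm_warmStart_sub_le hc0 hcsqrt hq0.le (by linarith) hr.le hstep henergy
      hT (fun t ht => (hshift T hT t ht).trans hs) hi
  have htrack : ∀ T K : ℕ, 1 ≤ T → v / T ≤ plRadius M Hi Hf γ / 2 →
      (1 - 5 / 3 * q) ^ K * (plRadius M Hi Hf γ / 2 + v / T) ≤ plRadius M Hi Hf γ / 2 →
      TracksGroundState P Hi Hf γ θs L T K := fun T K hT hs hK =>
    htrack₀ T K hT hs
      (norm_warmStart_sub_le hc0 (by linarith) hr.le hstep hT (hshift T hT) hs hK)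
  have hsl20 : 0 ≤ slices₂ M Hi Hf γ L := by rw [slices₂]; positivity
  have hD : 0 ≤ ‖Hf - Hi‖ := norm_nonneg _
  have hv1 : v = plRadius M Hi Hf γ / 2 * slices₁ M Hi Hf γ := by
    rw [hv, plRadius, slices₁]
    field_simp
  have hv2 : v = plRadius M Hi Hf γ / 2 * (q / 2 * slices₂ M Hi Hf γ L) := by
    rw [hv, plRadius, slices₂, hq]
    field_simp
    ring
  have hsteps : steps₁ Hi Hf γ L = 2 * Real.log 2 / q := by
    rw [steps₁, hq]
    field_simp
  have hlog : 0 < Real.log 2 := Real.log_pos one_lt_two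
  have hsteps0 : 0 ≤ steps₁ Hi Hf γ L := by rw [hsteps]; positivity
  -- one step per slice works with half as many slices as `slices₂`
  have htrack₂ : ∀ T : ℕ, 1 ≤ T → slices₂ M Hi Hf γ L ≤ 2 * T →
      TracksGroundState P Hi Hf γ θs L T 1 := by
    intro T hT hT2
    have hTpos : (0 : ℝ) < T := by exact_mod_cast hT
    have hs : v / T ≤ plRadius M Hi Hf γ / 2 * q := by
      rw [div_le_iff₀ hTpos, hv2, mul_assoc]
      refine mul_le_mul_of_nonneg_left ?_ (by linarith)
      linarith [mul_le_mul_of_nonneg_left hT2 hq0.le]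
    refine htrack T 1 hT (hs.trans (mul_le_of_le_one_right (by linarith) (by linarith))) ?_
    rw [pow_one]
    calc (1 - 5 / 3 * q) * (plRadius M Hi Hf γ / 2 + v / T)
        ≤ (1 - 5 / 3 * q) * (plRadius M Hi Hf γ / 2 + plRadius M Hi Hf γ / 2 * q) :=
          mul_le_mul_of_nonneg_left (by linarith) hc0
      _ = (1 - 5 / 3 * q) * (1 + q) * (plRadius M Hi Hf γ / 2) := by ring
      _ ≤ _ := mul_le_of_le_one_left (by linarith) (by nlinarith)
  have hsl1 : 0 ≤ slices₁ M Hi Hf γ := by rw [slices₁]; positivity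
  set bound := (M : ℝ) ^ 3 * pathNorm Hi Hf ^ 2 * ‖Hf - Hi‖ / (γ ^ 3 * minGap Hi Hf ^ 3) with hbd
  have hsl2 : slices₂ M Hi Hf γ L ≤ 384 * bound := by
    have hpow : (M : ℝ) ^ (3 / 2 : ℝ) * Real.sqrt M = (M : ℝ) ^ 2 := by
      rw [Real.sqrt_eq_rpow, ← Real.rpow_add hMpos, ← Real.rpow_natCast]
      norm_num
    calc slices₂ M Hi Hf γ L
        = 96 * pathNorm Hi Hf * ((M : ℝ) ^ (3 / 2 : ℝ) * Real.sqrt M) * ‖Hf - Hi‖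
            / (γ ^ 3 * minGap Hi Hf ^ 3) * L := by rw [slices₂, hessLip]; ring
      _ ≤ 96 * pathNorm Hi Hf * ((M : ℝ) ^ (3 / 2 : ℝ) * Real.sqrt M) * ‖Hf - Hi‖
            / (γ ^ 3 * minGap Hi Hf ^ 3) * (4 * pathNorm Hi Hf * M) :=
          mul_le_mul_of_nonneg_left hLM (by positivity)
      _ = 384 * bound := by rw [hpow, hbd]; ring
  have hprod : slices₁ M Hi Hf γ * steps₁ Hi Hf γ L ≤ 384 * Real.log 2 * bound := by
    have h : slices₁ M Hi Hf γ * steps₁ Hi Hf γ L = Real.log 2 * slices₂ M Hi Hf γ L := by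
      rw [slices₁, steps₁, slices₂]
      field_simp
      ring
    rw [h]
    linarith [mul_le_mul_of_nonneg_left hsl2 hlog.le]
  have hbd0 : 0 ≤ bound := by positivity
  refine ⟨fun T K hT hT1 hK => ?_, ?_, fun T hT hT2 => ?_, ?_⟩
  · have hTpos : (0 : ℝ) < T := by exact_mod_cast hT
    have hs : v / T ≤ plRadius M Hi Hf γ / 2 := by
      rw [div_le_iff₀ hTpos, hv1]
      exact mul_le_mul_of_nonneg_left hT1 (by linarith)
    refine htrack T K hT hs ?_
    have h1 := pow_mul_le_of_steps_le hq0 hc0 (by linarith) (hsteps ▸ hK)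
    calc (1 - 5 / 3 * q) ^ K * (plRadius M Hi Hf γ / 2 + v / T)
        ≤ (1 - 5 / 3 * q) ^ K * (plRadius M Hi Hf γ / 2 + plRadius M Hi Hf γ / 2) :=
          mul_le_mul_of_nonneg_left (by linarith) (pow_nonneg hc0 K)
      _ = (1 - 5 / 3 * q) ^ K * 2 * (plRadius M Hi Hf γ / 2) := by ring
      _ ≤ _ := mul_le_of_le_one_left (by linarith) h1
  · rcases le_or_gt (slices₁ M Hi Hf γ) 1 with h1 | h1
    · -- a single slice: the initial parameters are already close enough to the last minimizer
      have hceil : max 1 ⌈slices₁ M Hi Hf γ⌉₊ = 1 :=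
        max_eq_left (Nat.ceil_le.2 (by exact_mod_cast h1))
      have hvr : v / (1 : ℕ) ≤ plRadius M Hi Hf γ / 2 := by
        rw [Nat.cast_one, div_one, hv1]
        exact mul_le_of_le_one_right (by linarith) h1
      refine ⟨1, 0, hceil.symm, by simpa using hsteps0, ?_, htrack₀ 1 0 le_rfl hvr fun t ht => ?_⟩
      · simp only [mul_zero, Nat.cast_zero]
        positivity
      · rcases Nat.le_one_iff_eq_zero_or_eq_one.1 ht with rfl | rfl
        · simp only [warmStart, Nat.cast_zero, zero_div, sub_self, norm_zero]
          linarith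
        · have h := (hshift 1 le_rfl 0 zero_lt_one).trans hvr
          simpa [warmStart, descend] using h
    · set T := ⌈slices₁ M Hi Hf γ⌉₊ with hTdef
      have hT1 : 1 ≤ T := Nat.one_le_ceil_iff.2 (by linarith)
      have hTpos : (0 : ℝ) < T := by exact_mod_cast hT1
      have hle : slices₁ M Hi Hf γ ≤ T := Nat.le_ceil _
      set x := slices₁ M Hi Hf γ / T with hx
      have hx1 : x ≤ 1 := (div_le_one hTpos).2 hle
      have hx2 : 1 / 2 < x := by
        rw [hx, lt_div_iff₀ hTpos]
        linarith [Nat.ceil_lt_add_one hsl1]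
      have hvx : v / T = plRadius M Hi Hf γ / 2 * x := by rw [hv1, hx]; ring
      have hxs : 0 ≤ x * steps₁ Hi Hf γ L := mul_nonneg (by linarith) hsteps0
      refine ⟨T, ⌊x * steps₁ Hi Hf γ L⌋₊, (max_eq_right hT1).symm, ?_, ?_,
        htrack T _ hT1 ?_ ?_⟩
      · exact (Nat.floor_le hxs).trans (mul_le_of_le_one_left hsteps0 hx1)
      · rw [Nat.cast_mul]
        refine le_trans ?_ hprod
        calc (T : ℝ) * (⌊x * steps₁ Hi Hf γ L⌋₊ : ℝ) ≤ T * (x * steps₁ Hi Hf γ L) :=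
              mul_le_mul_of_nonneg_left (Nat.floor_le hxs) hTpos.le
          _ = slices₁ M Hi Hf γ * steps₁ Hi Hf γ L := by rw [hx]; field_simp
      · rw [hvx]
        exact mul_le_of_le_one_right (by linarith) hx1
      · have h := pow_floor_mul_le hq0 hq2 hx2
        rw [hvx, hsteps]
        calc _ = (1 - 5 / 3 * q) ^ ⌊x * (2 * Real.log 2 / q)⌋₊ * (1 + x)
              * (plRadius M Hi Hf γ / 2) := by ring
          _ ≤ _ := mul_le_of_le_one_left (by linarith) h
  · have hTpos : (0 : ℝ) ≤ T := Nat.cast_nonneg T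
    exact htrack₂ T hT (by linarith)
  · refine ⟨max 1 ⌊slices₂ M Hi Hf γ L⌋₊, le_max_left _ _, ?_, htrack₂ _ (le_max_left _ _) ?_⟩
    · rw [Nat.cast_max, Nat.cast_one]
      exact max_le_max le_rfl ((Nat.floor_le hsl20).trans hsl2)
    · rw [Nat.cast_max, Nat.cast_one]
      have h1 := Nat.lt_floor_add_one (slices₂ M Hi Hf γ L)
      have h2 := le_max_left (1 : ℝ) (⌊slices₂ M Hi Hf γ L⌋₊ : ℝ)
      have h3 := le_max_right (1 : ℝ) (⌊slices₂ M Hi Hf γ L⌋₊ : ℝ)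
      linarith
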